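/- Let $K$ be a field of characteristic zero and let $\mathfrak{sl}_2$ have the basis $e,f,h$ with $[e,f]=h$, $[e,h]=2e$, $[f,h]=-2f$. A (Leibniz) bimodule is a $K$-vector space $M$ with bilinear brackets $\mathfrak{sl}_2\times M\to M$ and $M\times\mathfrak{sl}_2\to M$ such that, for all $x,y\in\mathfrak{sl}_2$ and $m\in M$, $$[m,[x,y]]=[[m,x],y]-[[m,y],x],\quad [x,[m,y]]=[[x,m],y]-[[x,y],m],\quad [x,[y,m]]=[[x,y],m]-[[x,m],y].$$ It is indecomposable if it is nonzero and is not a direct sum of two nonzero subbimodules. For $d\ge 0$ let $V(d)$ be the right module with basis $v_0,\dots,v_d$ and $[v_i,h]=(d-2i)v_i$, $[v_i,f]=v_{i+1}$, $[v_i,e]=-i(d+1-i)v_{i-1}$, where $v_{-1}=v_{d+1}=0$. (1) Let $M$ be an indecomposable bimodule which, as a right module, is isomorphic to $V(n_1)\oplus\dots\oplus V(n_k)$ with $n_1\ge\dots\ge n_k\ge 0$. Then $n_i-n_{i+1}=2$ for all $1\le i\le k-1$. (2) Let $k\ge 1$, $n\ge 2(k-1)$ and $n_j=n-2j+2$ for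 $1\le j\le k$. Let $v^j_0,\dots,v^j_{n_j}$ be the above basis of $V(n_j)$, and set $v^j_i=0$ if $j\notin\{1,\dots,k\}$ or $i\notin\{0,\dots,n_j\}$. Consider the following formulas, for an index $1\le j\le k$ and $0\le i\le n_j$: $$\begin{aligned} [h,v_i^{j}]&=2(n_j-i+1)\,v_{i+1}^{j-1}-(n_j-2i)\,v_i^{j}-2i\,v_{i-1}^{j+1},\\ [f,v_i^{j}]&=v_{i+2}^{j-1}-v_{i+1}^{j}+v_i^{j+1},\\ [e,v_i^{j}]&=(n_j-i+1)\bigl((n_j-i+2)\,v_i^{j-1}+i\,v_{i-1}^{j}\bigr)+i(i-1)\,v_{i-2}^{j+1}. \end{aligned}$$ Each of the following two left actions makes the right module $V(n_1)\oplus\dots\oplus V(n_k)$ an indecomposable bimodule: first, the left action given by these formulas for all even $j$ and zero on $V(n_j)$ for all odd $j$; second, the left action given by these formulas for all odd $j$ and zero on $V(n_j)$ for all even $j$. Every indecomposable bimodule that is isomorphic to $V(n_1)\oplus\dots\oplus V(n_k)$ as a right module is isomorphic, as a bimodule, to one of these two. The two are isomorphic to each other if and only if $n=0$ (so $k=1$,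 and the bimodule is the trivial one-dimensional one). Thus, for $n\ge 1$, there are up to isomorphism exactly two indecomposable bimodules. -/

import Mathlib

open LieAlgebra.SpecialLinear

namespace LeibnizSl2

section Bimodule

variable {K L M : Type*} [Field K] [LieRing L] [LieAlgebra K L] [AddCommGroup M] [Module K M]

/-- `l x m` is the left bracket `[x, m]` and `r x m` is the right bracket `[m, x]`.
The pair makes `M` a Leibniz bimodule (a representation of the right Leibniz algebra `L`). -/
structure IsBimodule (l r : L →ₗ[K] Module.End K M) : Prop where
  /-- `[m, [x, y]] = [[m, x], y] - [[m, y], x]` -/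
  right_right : ∀ (x y : L) (m : M), r ⁅x, y⁆ m = r y (r x m) - r x (r y m)
  /-- `[x, [m, y]] = [[x, m], y] - [[x, y], m]` -/
  left_right : ∀ (x y : L) (m : M), l x (r y m) = r y (l x m) - l ⁅x, y⁆ m
  /-- `[x, [y, m]] = [[x, y], m] - [[x, m], y]` -/
  left_left : ∀ (x y : L) (m : M), l x (l y m) = l ⁅x, y⁆ m - r y (l x m)

/-- A subbimodule: a subspace stable under both actions. -/
def IsSubbimodule (l r : L →ₗ[K] Module.End K M) (N : Submodule K M) : Prop :=
  ∀ x : L, ∀ m ∈ N, l x m ∈ N ∧ r x m ∈ N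

/-- A nonzero bimodule which is not the direct sum of two nonzero subbimodules. -/
def IsIndecomposable (l r : L →ₗ[K] Module.End K M) : Prop :=
  Nontrivial M ∧ ∀ N₁ N₂ : Submodule K M, IsSubbimodule l r N₁ → IsSubbimodule l r N₂ →
    IsCompl N₁ N₂ → N₁ = ⊥ ∨ N₂ = ⊥

variable {M' : Type*} [AddCommGroup M'] [Module K M']

/-- Isomorphism of right modules. -/
def RightIso (r : L →ₗ[K] Module.End K M) (r' : L →ₗ[K] Module.End K M') : Prop :=
  ∃ φ : M ≃ₗ[K] M', ∀ (x : L) (m : M), φ (r x m) = r' x (φ m)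

/-- Isomorphism of bimodules. -/
def BimoduleIso (l r : L →ₗ[K] Module.End K M) (l' r' : L →ₗ[K] Module.End K M') : Prop :=
  ∃ φ : M ≃ₗ[K] M', ∀ (x : L) (m : M), φ (l x m) = l' x (φ m) ∧ φ (r x m) = r' x (φ m)

end Bimodule

section Sl2

variable (K : Type*) [Field K]

/-- The Lie algebra of traceless `2 × 2` matrices. -/
abbrev Sl2 : Type _ := sl (Fin 2) K

/-- The basis element `e`; the basis `e`, `f`, `h` is normalized so that
`[e, f] = h`, `[e, h] = 2 e`, `[f, h] = -2 f`. -/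
def slE : Sl2 K := ⟨!![0, 0; 1, 0], by simp [sl, Matrix.trace]⟩

/-- The basis element `f`. -/
def slF : Sl2 K := ⟨!![0, -1; 0, 0], by simp [sl, Matrix.trace]⟩

/-- The basis element `h`. -/
def slH : Sl2 K := ⟨!![1, 0; 0, -1], by simp [sl, Matrix.trace]⟩

theorem lie_e_f : ⁅slE K, slF K⁆ = slH K := by
  apply Subtype.ext
  rw [sl_bracket]
  ext i j
  fin_cases i <;> fin_cases j <;> simp [slE, slF, slH]

theorem lie_e_h : ⁅slE K, slH K⁆ = (2 : K) • slE K := by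
  apply Subtype.ext
  rw [sl_bracket]
  ext i j
  fin_cases i <;> fin_cases j <;> simp [slE, slH, ← one_add_one_eq_two]

theorem lie_f_h : ⁅slF K, slH K⁆ = (-2 : K) • slF K := by
  apply Subtype.ext
  rw [sl_bracket]
  ext i j
  fin_cases i <;> fin_cases j <;> simp [slF, slH, ← one_add_one_eq_two]

variable {K}

/-- The `(i, j)` matrix entry as a linear form. -/
def entry (i j : Fin 2) : Sl2 K →ₗ[K] K where
  toFun x := x.val i j
  map_add' _ _ := rfl
  map_smul' _ _ := rfl

theorem entry_apply (i j : Fin 2) (x : Sl2 K) : entry i j x = x.val i j := rfl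

variable {E : Type*} [AddCommGroup E] [Module K E]

/-- The linear map on `sl₂` with prescribed values `A`, `B`, `C` at `e`, `f`, `h`. -/
def ofTriple (A B C : E) : Sl2 K →ₗ[K] E :=
  (entry 1 0).smulRight A - (entry 0 1).smulRight B + (entry 0 0).smulRight C

theorem ofTriple_e (A B C : E) : ofTriple A B C (slE K) = A := by
  simp [ofTriple, entry_apply, slE]

theorem ofTriple_f (A B C : E) : ofTriple A B C (slF K) = B := by
  simp [ofTriple, entry_apply, slF]

theorem ofTriple_h (A B C : E) : ofTriple A B C (slH K) = C := by
  simp [ofTriple, entry_apply, slH]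

end Sl2

section Model

/-- Indices of the standard basis of `V(d₁) ⊕ ⋯ ⊕ V(d_k)`: a component `p` and a number
`0 ≤ i ≤ d_p`. The components are numbered from `0` in `Fin k`. -/
abbrev Index {k : ℕ} (d : Fin k → ℕ) : Type := Σ p : Fin k, Fin (d p + 1)

variable (K : Type*) [Field K] {k : ℕ} (d : Fin k → ℕ)

/-- The underlying space of `V(d₁) ⊕ ⋯ ⊕ V(d_k)`. -/
abbrev Space : Type _ := Index d → K

/-- The basis vector `v_i^p`, where the components are numbered `p = 1, …, k`
and `0 ≤ i ≤ d_p`; the vector is `0` for all other integers `p`, `i`. -/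
def vec (p i : ℤ) : Space K d :=
  fun a => if ((a.1 : ℕ) : ℤ) + 1 = p ∧ ((a.2 : ℕ) : ℤ) = i then 1 else 0

variable {d} in
/-- The linear endomorphism with `v_i^p ↦ g p i d_p` for `1 ≤ p ≤ k`, `0 ≤ i ≤ d_p`. -/
noncomputable def endOf (g : (p i m : ℤ) → Space K d) : Module.End K (Space K d) :=
  (Pi.basisFun K (Index d)).constr K fun a => g (((a.1 : ℕ) : ℤ) + 1) ((a.2 : ℕ) : ℤ) (d a.1 : ℤ)

/-- The right action on `V(d₁) ⊕ ⋯ ⊕ V(d_k)`: with `m = d_p`,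
`[v_i^p, h] = (m - 2i) v_i^p`, `[v_i^p, f] = v_{i+1}^p`, `[v_i^p, e] = -i (m + 1 - i) v_{i-1}^p`. -/
noncomputable def rightAction : Sl2 K →ₗ[K] Module.End K (Space K d) :=
  ofTriple
    (endOf K fun p i m => (-(i * (m + 1 - i))) • vec K d p (i - 1))
    (endOf K fun p i _ => vec K d p (i + 1))
    (endOf K fun p i m => (m - 2 * i) • vec K d p i)

/-- The left action which vanishes on the components `p` with `p ≢ c` modulo `2`, and which on the
components `p ≡ c` modulo `2` is given, with `m = d_p`, by
* `[e, v_i^p] = (m-i+1) ((m-i+2) v_i^{p-1} + i v_{i-1}^p) + i (i-1) v_{i-2}^{p+1}`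
* `[f, v_i^p] = v_{i+2}^{p-1} - v_{i+1}^p + v_i^{p+1}`
* `[h, v_i^p] = 2 (m-i+1) v_{i+1}^{p-1} - (m-2i) v_i^p - 2i v_{i-1}^{p+1}`. -/
noncomputable def leftAction (c : ℤ) : Sl2 K →ₗ[K] Module.End K (Space K d) :=
  ofTriple
    (endOf K fun p i m => if p ≡ c [ZMOD 2] then
      (m - i + 1) • ((m - i + 2) • vec K d (p - 1) i + i • vec K d p (i - 1))
        + (i * (i - 1)) • vec K d (p + 1) (i - 2) else 0)
    (endOf K fun p i _ => if p ≡ c [ZMOD 2] then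
      vec K d (p - 1) (i + 2) - vec K d p (i + 1) + vec K d (p + 1) i else 0)
    (endOf K fun p i m => if p ≡ c [ZMOD 2] then
      (2 * (m - i + 1)) • vec K d (p - 1) (i + 1) - (m - 2 * i) • vec K d p i
        - (2 * i) • vec K d (p + 1) (i - 1) else 0)

end Model

/-- The highest weights `n, n - 2, …, n - 2 (k - 1)`; used only when `2 (k - 1) ≤ n`. -/
def chain (n k : ℕ) : Fin k → ℕ := fun p => n - 2 * (p : ℕ)

section Kinds

variable (K : Type*) [Field K] (n k : ℕ)

/-- The right action on `V(n) ⊕ V(n - 2) ⊕ ⋯ ⊕ V(n - 2 (k - 1))`. -/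
noncomputable abbrev chainRight : Sl2 K →ₗ[K] Module.End K (Space K (chain n k)) :=
  rightAction K (chain n k)

/-- First kind: the left action is nonzero only on the components with even number. -/
noncomputable abbrev leftFirst : Sl2 K →ₗ[K] Module.End K (Space K (chain n k)) :=
  leftAction K (chain n k) 0

/-- Second kind: the left action is nonzero only on the components with odd number. -/
noncomputable abbrev leftSecond : Sl2 K →ₗ[K] Module.End K (Space K (chain n k)) :=
  leftAction K (chain n k) 1

end Kinds

end LeibnizSl2

open LeibnizSl2

/-!
Write `M = V(d₁) ⊕ ⋯ ⊕ V(d_k)` for the right module and let `ρ = -r` be the associated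
representation. The identity for `[x, [m, y]]` says that the left bracket is an equivariant map
`sl₂ ⊗ M → M`, and, given this, the identity for `[x, [y, m]]` says that `l x (l y + r y) = 0`.
Since `sl₂ ⊗ V(m) = V(m + 2) ⊕ V(m) ⊕ V(m - 2)`, the left bracket is described by three maps
`a`, `z`, `b` of degrees `2`, `0`, `-2` on the multiplicity space `Fin k → K`, which is graded by
highest weight (`leftOf`, `exists_eq_leftOf`). The other identity forces `z` to be idempotent and
`a`, `b` to map its range to its kernel and to vanish on its kernel (`IsZigzag`,
`exists_isZigzag`), where in degree zero `z` does not matter and can be chosen suitably.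

Thus in each degree the multiplicity space splits into sources (range of `z`) and sinks (kernel of
`z`), and `a`, `b` map the sources of degree `m` to the sinks of degrees `m + 2` and `m - 2`: the
bimodule is a representation of a quiver whose components are lines with alternating orientation.
The indecomposable representations of such a line are the intervals. Only one step of this is
needed: starting from the highest degree, `exists_splitting` finds an interval together with a
retraction onto it, by pushing a pair of subspaces `W < Q` forward along `b` or pulling it back
along `a` until the chain has to stop. For an indecomposable bimodule this makes it isomorphic to
the interval (`exists_iso_model`), which is one of the two explicit bimodules.

The highest weights are determined by the right module (`eq_of_rightIso`). The explicit bimodules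
are indecomposable since their endomorphisms are scalars (`isIndecomposable_model`), and they are
distinguished by whether the top component is a source, which is visible in `z` if its degree is
not zero (`leftFirst_iso_leftSecond_iff`).
-/

namespace LeibnizSl2

/-! ### Multiplicity spaces and lifted vectors -/

section Multiplicity

variable {K : Type*} [Field K] {k k' : ℕ} {d : Fin k → ℕ} {d' : Fin k' → ℕ}

variable (K) in
/-- The degree-`m` part of the multiplicity space `Fin k → K`: the span of the coordinate vectors
of those components `p` with `d p = m`. The degree is an integer, so that the parts of negative
degree are zero. -/
def homog (d : Fin k → ℕ) (m : ℤ) : Submodule K (Fin k → K) where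
  carrier := {u | ∀ p, (d p : ℤ) ≠ m → u p = 0}
  add_mem' hu hv p hp := by simp [hu p hp, hv p hp]
  zero_mem' _ _ := rfl
  smul_mem' c u hu p hp := by simp [hu p hp]

theorem mem_homog {m : ℤ} {u : Fin k → K} :
    u ∈ homog K d m ↔ ∀ p, (d p : ℤ) ≠ m → u p = 0 := Iff.rfl

theorem single_mem_homog (p : Fin k) (c : K) : Pi.single p c ∈ homog K d (d p) := by
  intro q hq
  rw [Pi.single_eq_of_ne]
  rintro rfl
  exact hq rfl

theorem eq_zero_of_mem_homog_of_neg {m : ℤ} {u : Fin k → K} (hu : u ∈ homog K d m) (hm : m < 0) :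
    u = 0 := by
  ext p
  exact hu p (by omega)

/-- Linear maps on the multiplicity space agree if they agree on homogeneous vectors. -/
theorem linearMap_ext_homog {E : Type*} [AddCommGroup E] [Module K E]
    {f g : (Fin k → K) →ₗ[K] E} (h : ∀ m : ℤ, 0 ≤ m → ∀ u ∈ homog K d m, f u = g u) : f = g :=
  (Pi.basisFun K (Fin k)).ext fun p => by
    rw [Pi.basisFun_apply]
    exact h _ (by positivity) _ (single_mem_homog p 1)

/-- `lev d i u` is the vector `∑ p, u p • v_i^p`: it identifies the multiplicity space with the
`i`-th level of `V(d₁) ⊕ ⋯ ⊕ V(d_k)`. Terms with `i ∉ {0, …, d p}` are zero. -/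
def lev (d : Fin k → ℕ) (i : ℤ) : (Fin k → K) →ₗ[K] Space K d where
  toFun u a := if ((a.2 : ℕ) : ℤ) = i then u a.1 else 0
  map_add' u v := by
    ext a
    by_cases h : ((a.2 : ℕ) : ℤ) = i <;> simp [h]
  map_smul' c u := by
    ext a
    by_cases h : ((a.2 : ℕ) : ℤ) = i <;> simp [h]

theorem lev_apply (i : ℤ) (u : Fin k → K) (a : Index d) :
    lev d i u a = if ((a.2 : ℕ) : ℤ) = i then u a.1 else 0 := rfl

theorem lev_zero_apply_zero (u : Fin k → K) (p : Fin k) : lev d 0 u ⟨p, 0⟩ = u p := by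
  simp [lev_apply]

theorem lev_apply_zero_of_ne {i : ℤ} (hi : i ≠ 0) (u : Fin k → K) (p : Fin k) :
    lev d i u ⟨p, 0⟩ = 0 := by
  simp [lev_apply, hi.symm]

theorem lev_eq_zero_of_neg {i : ℤ} (hi : i < 0) (u : Fin k → K) : lev d i u = 0 := by
  ext a
  rw [lev_apply, if_neg (by omega)]
  rfl

theorem lev_eq_zero_of_lt {m i : ℤ} {u : Fin k → K} (hu : u ∈ homog K d m) (hi : m < i) :
    lev d i u = 0 := by
  ext ⟨p, j⟩
  rw [lev_apply, Pi.zero_apply, ite_eq_right_iff]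
  intro h
  have := j.2
  exact hu p (by simp only at h; omega)

theorem lev_zero_injective : Function.Injective (lev d 0 : (Fin k → K) →ₗ[K] Space K d) := by
  intro u v h
  ext p
  rw [← lev_zero_apply_zero (d := d) u p, h, lev_zero_apply_zero]

theorem lev_single (p : Fin k) (i : ℤ) :
    lev d i (Pi.single p (1 : K)) = vec K d ((p : ℕ) + 1) i := by
  ext ⟨q, j⟩
  simp only [lev_apply, vec, Pi.single_apply]
  by_cases h : q = p
  · subst h; simp
  · have : ¬ ((q : ℕ) : ℤ) + 1 = (p : ℕ) + 1 := by
      intro h'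
      exact h (Fin.ext (by omega))
    simp [h, this]

theorem basisFun_eq_lev (a : Index d) :
    Pi.basisFun K (Index d) a = lev d ((a.2 : ℕ) : ℤ) (Pi.single a.1 1) := by
  obtain ⟨p, i⟩ := a
  rw [Pi.basisFun_apply]
  ext ⟨q, j⟩
  simp only [lev_apply, Pi.single_apply]
  by_cases h : q = p
  · subst h
    by_cases h' : j = i
    · subst h'; simp
    · have : ¬ ((j : ℕ) : ℤ) = i := fun h'' => h' (Fin.ext (by omega))
      simp [h', this]
  · have : ¬ (⟨q, j⟩ : Index d) = ⟨p, i⟩ := fun h' => h (congrArg Sigma.fst h')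
    simp [h, this]

/-- Linear maps on `V(d₁) ⊕ ⋯ ⊕ V(d_k)` agree if they agree on lifted homogeneous vectors. -/
theorem space_ext {E : Type*} [AddCommGroup E] [Module K E] {f g : Space K d →ₗ[K] E}
    (h : ∀ m i : ℤ, 0 ≤ i → i ≤ m → ∀ u ∈ homog K d m, f (lev d i u) = g (lev d i u)) : f = g :=
  (Pi.basisFun K (Index d)).ext fun a => by
    rw [basisFun_eq_lev]
    have := a.2.2
    exact h (d a.1) _ (by positivity) (by omega) _ (single_mem_homog a.1 1)

/-- The linear map with `lev d i u ↦ g i m u` for `u` of degree `m`. -/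
noncomputable def opOf {E : Type*} [AddCommGroup E] [Module K E]
    (g : ℤ → ℤ → (Fin k → K) →ₗ[K] E) : Space K d →ₗ[K] E :=
  (Pi.basisFun K (Index d)).constr K fun a => g ((a.2 : ℕ) : ℤ) (d a.1) (Pi.single a.1 1)

theorem opOf_lev {E : Type*} [AddCommGroup E] [Module K E]
    {g : ℤ → ℤ → (Fin k → K) →ₗ[K] E} {m i : ℤ} {u : Fin k → K} (hu : u ∈ homog K d m)
    (hi : 0 ≤ i) (hg : ∀ v ∈ homog K d m, m < i → g i m v = 0) :
    opOf (d := d) g (lev d i u) = g i m u := by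
  rw [opOf, Module.Basis.constr_apply_fintype, Fintype.sum_sigma]
  conv_rhs => rw [← Finset.univ_sum_single u, map_sum]
  refine Finset.sum_congr rfl fun p _ => ?_
  by_cases hp : (d p : ℤ) = m
  · have hsm : Pi.single p (u p) = u p • (Pi.single p 1 : Fin k → K) := by
      rw [← Pi.single_smul, smul_eq_mul, mul_one]
    rw [hsm, map_smul]
    by_cases him : i ≤ m
    · obtain ⟨j, rfl⟩ := Int.eq_ofNat_of_zero_le hi
      rw [Finset.sum_eq_single (⟨j, by omega⟩ : Fin (d p + 1))]
      · simp [lev_apply, hp]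
      · intro b _ hb
        have : ¬ ((b : ℕ) : ℤ) = j := fun h => hb (Fin.ext (by simpa using h))
        simp [lev_apply, this]
      · simp
    · have h1 := single_mem_homog (d := d) p (1 : K)
      rw [hp] at h1
      rw [hg _ h1 (by omega), smul_zero, lev_eq_zero_of_lt hu (by omega)]
      simp
  · rw [hu p hp, Pi.single_zero, map_zero]
    refine Finset.sum_eq_zero fun j _ => ?_
    simp [lev_apply, hu p hp]

theorem opOf_congr {E : Type*} [AddCommGroup E] [Module K E]
    {f : Index d → E} {g : ℤ → ℤ → (Fin k → K) →ₗ[K] E}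
    (h : ∀ a : Index d, f a = g ((a.2 : ℕ) : ℤ) (d a.1) (Pi.single a.1 1)) :
    (Pi.basisFun K (Index d)).constr K f = opOf (d := d) g :=
  congrArg _ (funext h)

end Multiplicity

/-! ### The right action in terms of levels -/

section RightAction

variable {K : Type*} [Field K] {k : ℕ} {d : Fin k → ℕ}

theorem right_f {i : ℤ} (hi : 0 ≤ i) (u : Fin k → K) :
    rightAction K d (slF K) (lev d i u) = lev d (i + 1) u := by
  have key : ∀ m, ∀ v ∈ homog K d m,
      rightAction K d (slF K) (lev d i v) = lev d (i + 1) v := by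
    intro m v hv
    rw [rightAction, ofTriple_f, endOf, opOf_congr (g := fun i _ => lev d (i + 1))]
    · exact opOf_lev hv hi fun w hw h => lev_eq_zero_of_lt hw (by omega)
    · intro a
      rw [lev_single]
  have := linearMap_ext_homog (d := d) (f := rightAction K d (slF K) ∘ₗ lev d i)
    (g := lev d (i + 1)) fun m _ v hv => key m v hv
  exact LinearMap.congr_fun this u

theorem right_h {m : ℤ} {u : Fin k → K} (hu : u ∈ homog K d m) (i : ℤ) :
    rightAction K d (slH K) (lev d i u) = (m - 2 * i) • lev d i u := by
  rcases lt_or_ge i 0 with hi | hi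
  · simp [lev_eq_zero_of_neg hi]
  rw [rightAction, ofTriple_h, endOf, opOf_congr (g := fun i m => (m - 2 * i) • lev d i)]
  · exact opOf_lev hu hi fun w hw h => by simp [lev_eq_zero_of_lt hw h]
  · intro a
    rw [← lev_single, LinearMap.smul_apply]

theorem right_e {m : ℤ} {u : Fin k → K} (hu : u ∈ homog K d m) (i : ℤ) :
    rightAction K d (slE K) (lev d i u) = (-(i * (m + 1 - i))) • lev d (i - 1) u := by
  rcases lt_or_ge i 0 with hi | hi
  · rw [lev_eq_zero_of_neg hi, lev_eq_zero_of_neg (by omega), map_zero, smul_zero]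
  rw [rightAction, ofTriple_e, endOf,
    opOf_congr (g := fun i m => (-(i * (m + 1 - i))) • lev d (i - 1))]
  · refine opOf_lev hu hi fun w hw h => ?_
    rcases (show i = m + 1 ∨ m < i - 1 by omega) with h' | h'
    · rw [h']; simp
    · simp [lev_eq_zero_of_lt hw h']
  · intro a
    rw [← lev_single, LinearMap.smul_apply]

end RightAction

/-! ### Left actions given by three maps on the multiplicity space -/

section LeftAction

variable {K : Type*} [Field K] {k : ℕ} {d : Fin k → ℕ}

/-- The maps `a`, `z`, `b` of the multiplicity space have degrees `2`, `0` and `-2`. -/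
structure IsGraded (d : Fin k → ℕ) (a z b : Module.End K (Fin k → K)) : Prop where
  up : ∀ m : ℤ, ∀ u ∈ homog K d m, a u ∈ homog K d (m + 2)
  diag : ∀ m : ℤ, ∀ u ∈ homog K d m, z u ∈ homog K d m
  down : ∀ m : ℤ, ∀ u ∈ homog K d m, b u ∈ homog K d (m - 2)

/-- The left action on `V(d₁) ⊕ ⋯ ⊕ V(d_k)` whose components `V(m) → V(m + 2)`, `V(m) → V(m)` and
`V(m) → V(m - 2)` are the standard equivariant maps, with multiplicities `a`, `z` and `b`.
Explicitly, for `u` of degree `m`, writing `v_i` for `lev d i`,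
* `[e, v_i u] = (m-i+1)(m-i+2) v_i (a u) + (m-i+1) i v_{i-1} (z u) + i (i-1) v_{i-2} (b u)`
* `[f, v_i u] = v_{i+2} (a u) - v_{i+1} (z u) + v_i (b u)`
* `[h, v_i u] = 2 (m-i+1) v_{i+1} (a u) - (m-2i) v_i (z u) - 2i v_{i-1} (b u)`. -/
noncomputable def leftOf (d : Fin k → ℕ) (a z b : Module.End K (Fin k → K)) :
    Sl2 K →ₗ[K] Module.End K (Space K d) :=
  ofTriple
    (opOf fun i m => ((m - i + 1) * (m - i + 2)) • lev d i ∘ₗ a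
      + ((m - i + 1) * i) • lev d (i - 1) ∘ₗ z + (i * (i - 1)) • lev d (i - 2) ∘ₗ b)
    (opOf fun i _ => lev d (i + 2) ∘ₗ a - lev d (i + 1) ∘ₗ z + lev d i ∘ₗ b)
    (opOf fun i m => (2 * (m - i + 1)) • lev d (i + 1) ∘ₗ a - (m - 2 * i) • lev d i ∘ₗ z
      - (2 * i) • lev d (i - 1) ∘ₗ b)

variable {a z b : Module.End K (Fin k → K)} {m i : ℤ} {u : Fin k → K}

theorem left_e (hg : IsGraded d a z b) (hu : u ∈ homog K d m) (hi : 0 ≤ i) :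
    leftOf d a z b (slE K) (lev d i u) = ((m - i + 1) * (m - i + 2)) • lev d i (a u)
      + ((m - i + 1) * i) • lev d (i - 1) (z u) + (i * (i - 1)) • lev d (i - 2) (b u) := by
  rw [leftOf, ofTriple_e, opOf_lev hu hi]
  · simp
  · intro w hw h
    have hb : lev d (i - 2) (b w) = 0 := lev_eq_zero_of_lt (hg.down m w hw) (by omega)
    simp only [LinearMap.add_apply, LinearMap.smul_apply, LinearMap.comp_apply, hb]
    obtain rfl | h' := (show i = m + 1 ∨ m + 1 < i by omega)
    · simp
    have hz : lev d (i - 1) (z w) = 0 := lev_eq_zero_of_lt (hg.diag m w hw) (by omega)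
    obtain rfl | h'' := (show i = m + 2 ∨ m + 2 < i by omega)
    · simp [hz]
    · simp [hz, lev_eq_zero_of_lt (hg.up m w hw) h'']

theorem left_f (hg : IsGraded d a z b) (hu : u ∈ homog K d m) (hi : 0 ≤ i) :
    leftOf d a z b (slF K) (lev d i u) =
      lev d (i + 2) (a u) - lev d (i + 1) (z u) + lev d i (b u) := by
  rw [leftOf, ofTriple_f, opOf_lev hu hi]
  · simp
  · intro w hw h
    simp [lev_eq_zero_of_lt (hg.down m w hw) (show m - 2 < i by omega),
      lev_eq_zero_of_lt (hg.diag m w hw) (show m < i + 1 by omega),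
      lev_eq_zero_of_lt (hg.up m w hw) (show m + 2 < i + 2 by omega)]

theorem left_h (hg : IsGraded d a z b) (hu : u ∈ homog K d m) (hi : 0 ≤ i) :
    leftOf d a z b (slH K) (lev d i u) = (2 * (m - i + 1)) • lev d (i + 1) (a u)
      - (m - 2 * i) • lev d i (z u) - (2 * i) • lev d (i - 1) (b u) := by
  rw [leftOf, ofTriple_h, opOf_lev hu hi]
  · simp
  · intro w hw h
    have hb : lev d (i - 1) (b w) = 0 := lev_eq_zero_of_lt (hg.down m w hw) (by omega)
    have hz : lev d i (z w) = 0 := lev_eq_zero_of_lt (hg.diag m w hw) h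
    simp only [LinearMap.sub_apply, LinearMap.smul_apply, LinearMap.comp_apply, hb, hz]
    obtain rfl | h' := (show i = m + 1 ∨ m + 1 < i by omega)
    · simp
    · simp [lev_eq_zero_of_lt (hg.up m w hw) (show m + 2 < i + 1 by omega)]

end LeftAction

/-! ### Bimodule identities for the standard left actions -/

section Bimodule

variable {K : Type*} [Field K]

theorem sl2_induction {P : Sl2 K → Prop} (he : P (slE K)) (hf : P (slF K)) (hh : P (slH K))
    (hadd : ∀ x y, P x → P y → P (x + y)) (hsmul : ∀ (c : K) x, P x → P (c • x)) (x : Sl2 K) :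
    P x := by
  have hx : x = x.val 1 0 • slE K + (-x.val 0 1) • slF K + x.val 0 0 • slH K := by
    have htr : x.val 1 1 = -x.val 0 0 := by
      have h : Matrix.trace x.val = 0 := x.2
      have h' : x.val 0 0 + x.val 1 1 = 0 := by simpa [Matrix.trace, Fin.sum_univ_two] using h
      exact eq_neg_of_add_eq_zero_right h'
    apply Subtype.ext
    ext i j
    fin_cases i <;> fin_cases j <;> simp [slE, slF, slH, htr]
  rw [hx]
  exact hadd _ _ (hadd _ _ (hsmul _ _ he) (hsmul _ _ hf)) (hsmul _ _ hh)

theorem level_cases {i : ℤ} (hi : 0 ≤ i) : i = 0 ∨ i = 1 ∨ i = 2 ∨ ∃ j, 0 ≤ j ∧ i = j + 3 := by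
  by_cases h : 3 ≤ i
  · exact Or.inr (Or.inr (Or.inr ⟨i - 3, by omega, by omega⟩))
  · omega

theorem lie_f_e : ⁅slF K, slE K⁆ = -slH K := by rw [← lie_skew, lie_e_f]

theorem lie_h_e : ⁅slH K, slE K⁆ = (-2 : K) • slE K := by rw [← lie_skew, lie_e_h, neg_smul]

theorem lie_h_f : ⁅slH K, slF K⁆ = (2 : K) • slF K := by
  rw [← lie_skew, lie_f_h, neg_smul, neg_neg]

variable {M : Type*} [AddCommGroup M] [Module K M] {l r : Sl2 K →ₗ[K] Module.End K M}

/-- Equivariance of a left action is linear in both elements of `sl₂`, hence needs to be checked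
on the basis only. -/
theorem left_right_of_basis
    (h : ∀ x ∈ ({slE K, slF K, slH K} : Set (Sl2 K)), ∀ y ∈ ({slE K, slF K, slH K} : Set (Sl2 K)),
      l x * r y = r y * l x - l ⁅x, y⁆) (x y : Sl2 K) : l x * r y = r y * l x - l ⁅x, y⁆ := by
  have add₂ : ∀ x y y', l x * r y = r y * l x - l ⁅x, y⁆ →
      l x * r y' = r y' * l x - l ⁅x, y'⁆ →
      l x * r (y + y') = r (y + y') * l x - l ⁅x, y + y'⁆ := by
    intro x y y' h h'
    rw [map_add, mul_add, h, h', lie_add, map_add, add_mul]; abel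
  have smul₂ : ∀ x (c : K) y, l x * r y = r y * l x - l ⁅x, y⁆ →
      l x * r (c • y) = r (c • y) * l x - l ⁅x, c • y⁆ := by
    intro x c y h
    rw [map_smul, mul_smul_comm, h, lie_smul, map_smul, smul_mul_assoc, smul_sub]
  have add₁ : ∀ x x' y, l x * r y = r y * l x - l ⁅x, y⁆ →
      l x' * r y = r y * l x' - l ⁅x', y⁆ →
      l (x + x') * r y = r y * l (x + x') - l ⁅x + x', y⁆ := by
    intro x x' y h h'
    rw [map_add, add_mul, h, h', add_lie, map_add, mul_add]; abel
  have smul₁ : ∀ (c : K) x y, l x * r y = r y * l x - l ⁅x, y⁆ →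
      l (c • x) * r y = r y * l (c • x) - l ⁅c • x, y⁆ := by
    intro c x y h
    rw [map_smul, smul_mul_assoc, h, smul_lie, map_smul, mul_smul_comm, smul_sub]
  have step : ∀ x ∈ ({slE K, slF K, slH K} : Set (Sl2 K)), ∀ y, l x * r y = r y * l x - l ⁅x, y⁆ :=
    fun x hx => sl2_induction (h x hx _ (by simp)) (h x hx _ (by simp)) (h x hx _ (by simp))
      (add₂ x) (smul₂ x)
  exact sl2_induction (P := fun x => ∀ y, l x * r y = r y * l x - l ⁅x, y⁆)
    (step _ (by simp)) (step _ (by simp)) (step _ (by simp))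
    (fun x x' h h' y => add₁ x x' y (h y) (h' y)) (fun c x h y => smul₁ c x y (h y)) x y

theorem left_left_of_basis
    (h : ∀ x ∈ ({slE K, slF K, slH K} : Set (Sl2 K)), ∀ y ∈ ({slE K, slF K, slH K} : Set (Sl2 K)),
      l x * (l y + r y) = 0) (x y : Sl2 K) : l x * (l y + r y) = 0 := by
  have step : ∀ x ∈ ({slE K, slF K, slH K} : Set (Sl2 K)), ∀ y, l x * (l y + r y) = 0 := by
    refine fun x hx => sl2_induction (h x hx _ (by simp)) (h x hx _ (by simp)) (h x hx _ (by simp))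
      (fun y y' h h' => ?_) (fun c y h => ?_)
    · rw [map_add, map_add, add_add_add_comm, mul_add, h, h', add_zero]
    · rw [map_smul, map_smul, ← smul_add, mul_smul_comm, h, smul_zero]
  exact sl2_induction (P := fun x => ∀ y, l x * (l y + r y) = 0)
    (step _ (by simp)) (step _ (by simp)) (step _ (by simp))
    (fun x x' h h' y => by rw [map_add, add_mul, h, h', add_zero])
    (fun c x h y => by rw [map_smul, smul_mul_assoc, h, smul_zero]) x y

variable {k : ℕ} {d : Fin k → ℕ} {a z b : Module.End K (Fin k → K)}

theorem leftOf_mul_right (hg : IsGraded d a z b) (x y : Sl2 K) :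
    leftOf d a z b x * rightAction K d y =
      rightAction K d y * leftOf d a z b x - leftOf d a z b ⁅x, y⁆ := by
  refine left_right_of_basis (fun x hx y hy => ?_) x y
  refine space_ext fun m i hi _ u hu => ?_
  have e0 := fun j (hj : 0 ≤ j) => left_e (i := j) hg hu hj
  have f0 := fun j (hj : 0 ≤ j) => left_f (i := j) hg hu hj
  have h0 := fun j (hj : 0 ≤ j) => left_h (i := j) hg hu hj
  have re0 := right_e hu
  have rea := right_e (hg.up m u hu)
  have rez := right_e (hg.diag m u hu)
  have reb := right_e (hg.down m u hu)
  have rh0 := right_h hu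
  have rha := right_h (hg.up m u hu)
  have rhz := right_h (hg.diag m u hu)
  have rhb := right_h (hg.down m u hu)
  -- Levels down to `i - 3` occur in the products, and `right_f` needs a nonnegative level.
  obtain rfl | rfl | rfl | ⟨j, hj, rfl⟩ := level_cases hi
  all_goals
    rcases hx with rfl | rfl | rfl <;> rcases hy with rfl | rfl | rfl <;>
    simp (disch := omega) only [Module.End.mul_apply, LinearMap.sub_apply, lie_self, lie_e_f,
      lie_e_h, lie_f_h, lie_f_e, lie_h_e, lie_h_f, map_neg, map_smul, map_zero, map_add, map_sub,
      map_zsmul, LinearMap.neg_apply, LinearMap.smul_apply, LinearMap.zero_apply, e0, f0, h0, re0,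
      rea, rez, reb, rh0, rha, rhz, rhb, right_f, add_sub_assoc, add_assoc, Int.reduceSub,
      Int.reduceAdd, add_zero, zero_mul, mul_zero, lev_eq_zero_of_neg, smul_zero,
      Int.reduceNeg, neg_zero, sub_self, zero_add] <;>
    module

/-- The maps of the multiplicity space satisfy the relations which make the left action `leftOf`
a bimodule structure: `z` is idempotent, `a` and `b` vanish on its kernel and have values in it. -/
structure IsZigzag (a z b : Module.End K (Fin k → K)) : Prop where
  diag_diag : ∀ u, z (z u) = z u
  up_diag : ∀ u, a (z u) = a u
  diag_up : ∀ u, z (a u) = 0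
  down_diag : ∀ u, b (z u) = b u
  diag_down : ∀ u, z (b u) = 0

namespace IsZigzag

theorem up_up (hz : IsZigzag a z b) (u : Fin k → K) : a (a u) = 0 := by
  rw [← hz.up_diag, hz.diag_up, map_zero]

theorem up_down (hz : IsZigzag a z b) (u : Fin k → K) : a (b u) = 0 := by
  rw [← hz.up_diag, hz.diag_down, map_zero]

theorem down_up (hz : IsZigzag a z b) (u : Fin k → K) : b (a u) = 0 := by
  rw [← hz.down_diag, hz.diag_up, map_zero]

theorem down_down (hz : IsZigzag a z b) (u : Fin k → K) : b (b u) = 0 := by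
  rw [← hz.down_diag, hz.diag_down, map_zero]

end IsZigzag

theorem leftOf_mul_add (hg : IsGraded d a z b) (hz : IsZigzag a z b) (x y : Sl2 K) :
    leftOf d a z b x * (leftOf d a z b y + rightAction K d y) = 0 := by
  refine left_left_of_basis (fun x hx y hy => ?_) x y
  refine space_ext fun m i hi _ u hu => ?_
  have e0 := fun j (hj : 0 ≤ j) => left_e (i := j) hg hu hj
  have f0 := fun j (hj : 0 ≤ j) => left_f (i := j) hg hu hj
  have h0 := fun j (hj : 0 ≤ j) => left_h (i := j) hg hu hj
  have ea := fun j (hj : 0 ≤ j) => left_e (i := j) hg (hg.up m u hu) hj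
  have fa := fun j (hj : 0 ≤ j) => left_f (i := j) hg (hg.up m u hu) hj
  have ha := fun j (hj : 0 ≤ j) => left_h (i := j) hg (hg.up m u hu) hj
  have ez := fun j (hj : 0 ≤ j) => left_e (i := j) hg (hg.diag m u hu) hj
  have fz := fun j (hj : 0 ≤ j) => left_f (i := j) hg (hg.diag m u hu) hj
  have hz' := fun j (hj : 0 ≤ j) => left_h (i := j) hg (hg.diag m u hu) hj
  have eb := fun j (hj : 0 ≤ j) => left_e (i := j) hg (hg.down m u hu) hj
  have fb := fun j (hj : 0 ≤ j) => left_f (i := j) hg (hg.down m u hu) hj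
  have hb := fun j (hj : 0 ≤ j) => left_h (i := j) hg (hg.down m u hu) hj
  have re0 := right_e hu
  have rh0 := right_h hu
  obtain rfl | rfl | rfl | ⟨j, hj, rfl⟩ := level_cases hi
  all_goals
    rcases hx with rfl | rfl | rfl <;> rcases hy with rfl | rfl | rfl <;>
    simp (disch := omega) only [Module.End.mul_apply, LinearMap.add_apply, map_zero,
      map_add, map_sub, map_zsmul, LinearMap.zero_apply, e0, f0, h0, re0, ea, fa, ha,
      ez, fz, hz', eb, fb, hb, rh0, right_f, hz.diag_diag, hz.up_diag, hz.diag_up, hz.down_diag,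
      hz.diag_down, hz.up_up, hz.up_down, hz.down_up, hz.down_down, add_sub_assoc, add_assoc,
      Int.reduceSub, Int.reduceAdd, add_zero, zero_mul, mul_zero, lev_eq_zero_of_neg,
      smul_zero, Int.reduceNeg, neg_zero, sub_self, zero_add] <;>
    module

theorem rightAction_lie (x y : Sl2 K) : rightAction K d ⁅x, y⁆ =
    rightAction K d y * rightAction K d x - rightAction K d x * rightAction K d y := by
  have h1 : IsGraded d (0 : Module.End K (Fin k → K)) 1 0 :=
    ⟨fun _ _ _ => zero_mem _, fun _ _ h => h, fun _ _ _ => zero_mem _⟩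
  -- With multiplicities `0, 1, 0` the standard left action is the negative of the right one.
  have h2 : leftOf d (0 : Module.End K (Fin k → K)) 1 0 = -rightAction K d := by
    refine LinearMap.ext (sl2_induction ?_ ?_ ?_ (fun x y hx hy => ?_) (fun c x hx => ?_))
    · refine space_ext fun m i hi _ u hu => ?_
      rw [left_e h1 hu hi, LinearMap.neg_apply, LinearMap.neg_apply, right_e hu]
      simp only [LinearMap.zero_apply, Module.End.one_apply, map_zero]
      module
    · refine space_ext fun m i hi _ u hu => ?_
      rw [left_f h1 hu hi, LinearMap.neg_apply, LinearMap.neg_apply, right_f hi]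
      simp
    · refine space_ext fun m i hi _ u hu => ?_
      rw [left_h h1 hu hi, LinearMap.neg_apply, LinearMap.neg_apply, right_h hu]
      simp only [LinearMap.zero_apply, Module.End.one_apply, map_zero]
      module
    · rw [map_add, hx, hy, map_add]
    · rw [map_smul, hx, map_smul]
  refine LinearMap.ext fun v => ?_
  have h3 := leftOf_mul_right h1 x y
  rw [h2] at h3
  have h4 : -rightAction K d x (rightAction K d y v) =
      rightAction K d y (-rightAction K d x v) - -rightAction K d ⁅x, y⁆ v :=
    LinearMap.congr_fun h3 v
  rw [map_neg] at h4
  rw [LinearMap.sub_apply, Module.End.mul_apply, Module.End.mul_apply, sub_eq_add_neg, h4]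
  abel

theorem isBimodule_leftOf (hg : IsGraded d a z b) (hz : IsZigzag a z b) :
    IsBimodule (leftOf d a z b) (rightAction K d) where
  right_right x y m := by rw [rightAction_lie]; rfl
  left_right x y m := LinearMap.congr_fun (leftOf_mul_right hg x y) m
  left_left x y m := by
    have h1 := LinearMap.congr_fun (leftOf_mul_right hg x y) m
    have h2 := LinearMap.congr_fun (leftOf_mul_add hg hz x y) m
    simp only [Module.End.mul_apply, LinearMap.sub_apply, LinearMap.add_apply, map_add,
      LinearMap.zero_apply] at h1 h2
    rw [eq_neg_of_add_eq_zero_left h2, h1, neg_sub]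

end Bimodule

/-! ### Every left action is a standard one -/

section Classification

variable {K : Type*} [Field K] {k : ℕ} {d : Fin k → ℕ}

/-- The coefficients at the highest weight vectors `v_0^p`. -/
def top (d : Fin k → ℕ) : Space K d →ₗ[K] (Fin k → K) where
  toFun y p := y ⟨p, 0⟩
  map_add' _ _ := rfl
  map_smul' _ _ := rfl

theorem top_lev_zero (u : Fin k → K) : top d (lev d 0 u) = u :=
  funext (lev_zero_apply_zero u)

theorem top_lev_of_ne {i : ℤ} (hi : i ≠ 0) (u : Fin k → K) : top d (lev d i u) = 0 :=
  funext (lev_apply_zero_of_ne hi u)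

/-- The diagonal endomorphism of the multiplicity space which multiplies vectors of degree `m`
by `c m`. -/
def scaleDeg (d : Fin k → ℕ) (c : ℤ → K) : Module.End K (Fin k → K) where
  toFun u p := c (d p) * u p
  map_add' u v := by ext p; simp [mul_add]
  map_smul' t u := by ext p; simp [mul_left_comm]

theorem scaleDeg_of_mem {c : ℤ → K} {m : ℤ} {u : Fin k → K} (hu : u ∈ homog K d m) :
    scaleDeg d c u = c m • u := by
  ext p
  by_cases hp : (d p : ℤ) = m
  · simp [scaleDeg, hp]
  · simp [scaleDeg, hu p hp]

/-- The projection of the multiplicity space onto its part of degree `n`. -/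
def projDeg (d : Fin k → ℕ) (n : ℤ) : Module.End K (Fin k → K) :=
  scaleDeg d fun m => if m = n then 1 else 0

theorem projDeg_of_mem {n : ℤ} {u : Fin k → K} (hu : u ∈ homog K d n) : projDeg d n u = u := by
  rw [projDeg, scaleDeg_of_mem hu, if_pos rfl, one_smul]

theorem projDeg_of_mem_of_ne {m n : ℤ} (h : m ≠ n) {u : Fin k → K} (hu : u ∈ homog K d m) :
    projDeg d n u = 0 := by
  rw [projDeg, scaleDeg_of_mem hu, if_neg h, zero_smul]

theorem projDeg_mem (n : ℤ) (u : Fin k → K) : projDeg d n u ∈ homog K d n := by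
  intro p hp
  simp [projDeg, scaleDeg, hp]

theorem right_h_apply (y : Space K d) (a : Index d) :
    rightAction K d (slH K) y a = ((d a.1 : ℤ) - 2 * ((a.2 : ℕ) : ℤ)) • y a := by
  have : LinearMap.proj a ∘ₗ rightAction K d (slH K) =
      ((d a.1 : ℤ) - 2 * ((a.2 : ℕ) : ℤ)) • (LinearMap.proj a : Space K d →ₗ[K] K) := by
    refine space_ext fun m i hi _ u hu => ?_
    rw [LinearMap.comp_apply, right_h hu, LinearMap.smul_apply, LinearMap.proj_apply,
      LinearMap.proj_apply, Pi.smul_apply, lev_apply]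
    split_ifs with h
    · by_cases hp : (d a.1 : ℤ) = m
      · rw [hp, h]
      · rw [hu _ hp, smul_zero, smul_zero]
    · rw [smul_zero, smul_zero]
  exact LinearMap.congr_fun this y

theorem right_e_apply (y : Space K d) (p : Fin k) {i : ℕ} (hi : i + 1 < d p + 1) :
    rightAction K d (slE K) y ⟨p, ⟨i, by omega⟩⟩ =
      (-(((i : ℤ) + 1) * ((d p : ℤ) - i))) • y ⟨p, ⟨i + 1, hi⟩⟩ := by
  have : LinearMap.proj (⟨p, ⟨i, by omega⟩⟩ : Index d) ∘ₗ rightAction K d (slE K) =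
      (-(((i : ℤ) + 1) * ((d p : ℤ) - i))) •
        (LinearMap.proj (⟨p, ⟨i + 1, hi⟩⟩ : Index d) : Space K d →ₗ[K] K) := by
    refine space_ext fun m j hj _ u hu => ?_
    rw [LinearMap.comp_apply, right_e hu, LinearMap.smul_apply, LinearMap.proj_apply,
      LinearMap.proj_apply, Pi.smul_apply, lev_apply, lev_apply]
    by_cases hp : (d p : ℤ) = m
    · by_cases h : j = i + 1
      · subst h
        rw [if_pos (by simp), if_pos (by simp), hp]
        congr 1
        ring
      · rw [if_neg, if_neg, smul_zero, smul_zero]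
        · simp only [Nat.cast_add, Nat.cast_one]; omega
        · simp only; omega
    · simp [hu p hp]
  exact LinearMap.congr_fun this y

/-- The image of `e` has no lowest weight component. -/
theorem right_e_apply_last (y : Space K d) (p : Fin k) :
    rightAction K d (slE K) y ⟨p, Fin.last _⟩ = 0 := by
  have : LinearMap.proj (⟨p, Fin.last _⟩ : Index d) ∘ₗ rightAction K d (slE K) = 0 := by
    refine space_ext fun m j hj hjm u hu => ?_
    rw [LinearMap.comp_apply, right_e hu, LinearMap.proj_apply, Pi.smul_apply, lev_apply]
    by_cases hp : (d p : ℤ) = m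
    · rw [if_neg, smul_zero]; rfl
      simp only [Fin.val_last]; omega
    · simp [hu p hp]
  exact LinearMap.congr_fun this y

/-- An equivariant left action is determined by its values on highest weight vectors. -/
theorem left_ext {l l' : Sl2 K →ₗ[K] Module.End K (Space K d)}
    (hl : ∀ x y v, l x (rightAction K d y v) = rightAction K d y (l x v) - l ⁅x, y⁆ v)
    (hl' : ∀ x y v, l' x (rightAction K d y v) = rightAction K d y (l' x v) - l' ⁅x, y⁆ v)
    (h : ∀ x, ∀ m : ℤ, 0 ≤ m → ∀ u ∈ homog K d m, l x (lev d 0 u) = l' x (lev d 0 u)) :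
    l = l' := by
  have key : ∀ m : ℤ, 0 ≤ m → ∀ u ∈ homog K d m, ∀ i : ℕ, ∀ x,
      l x (lev d i u) = l' x (lev d i u) := by
    intro m hm u hu i
    induction i with
    | zero => exact fun x => h x m hm u hu
    | succ i ih =>
      intro x
      rw [Nat.cast_succ, ← right_f (by positivity), hl, hl', ih, ih]
  refine LinearMap.ext fun x => space_ext fun m i hi him u hu => ?_
  obtain ⟨j, rfl⟩ := Int.eq_ofNat_of_zero_le hi
  exact key m (by omega) u hu j x

variable [CharZero K]

/-- A vector of weight `n` killed by `e` is a combination of the `v_0^p` with `d p = n`. -/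
theorem highest_weight {n : ℤ} {y : Space K d} (he : rightAction K d (slE K) y = 0)
    (hh : rightAction K d (slH K) y = n • y) : top d y ∈ homog K d n ∧ lev d 0 (top d y) = y := by
  constructor
  · intro p hp
    have h := congrFun hh ⟨p, 0⟩
    rw [right_h_apply, Pi.smul_apply, ← sub_eq_zero, ← sub_smul, smul_eq_zero] at h
    refine h.resolve_left fun h' => hp ?_
    simp only [Fin.val_zero, Nat.cast_zero] at h'
    omega
  · ext ⟨p, ⟨i, hi⟩⟩
    cases i with
    | zero => exact lev_zero_apply_zero _ _
    | succ i =>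
      have h := congrFun he ⟨p, ⟨i, by omega⟩⟩
      rw [right_e_apply y p hi, Pi.zero_apply, smul_eq_zero] at h
      rw [lev_apply, if_neg (by simp only [Nat.cast_add, Nat.cast_one]; omega)]
      refine (h.resolve_left fun h' => ?_).symm
      rw [neg_eq_zero, mul_eq_zero] at h'
      omega

/-- Every equivariant left action is a standard one. The maps `a`, `z`, `b` are read off from the
values at highest weight vectors `v_0`, where the right action by `e` and `h` shows successively
that `[e, v_0]`, `[h, v_0]` and `[f, v_0]` have the required form. -/
theorem exists_eq_leftOf {l : Sl2 K →ₗ[K] Module.End K (Space K d)}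
    (hl : ∀ x y v, l x (rightAction K d y v) = rightAction K d y (l x v) - l ⁅x, y⁆ v) :
    ∃ a z b : Module.End K (Fin k → K), IsGraded d a z b ∧ l = leftOf d a z b := by
  have hr : ∀ x y v, rightAction K d y (l x v) = l x (rightAction K d y v) + l ⁅x, y⁆ v :=
    fun x y v => by rw [hl]; abel
  let a : Module.End K (Fin k → K) :=
    top d ∘ₗ l (slE K) ∘ₗ lev d 0 ∘ₗ scaleDeg d fun m => (((m : K) + 1) * (m + 2))⁻¹
  let z : Module.End K (Fin k → K) :=
    top d ∘ₗ l (slH K) ∘ₗ lev d 0 ∘ₗ scaleDeg d fun m => (-(m : K))⁻¹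
  let b : Module.End K (Fin k → K) := top d ∘ₗ l (slF K) ∘ₗ lev d 0
  have ha : ∀ m : ℤ, ∀ u ∈ homog K d m, a u =
      (((m : K) + 1) * (m + 2))⁻¹ • top d (l (slE K) (lev d 0 u)) := by
    intro m u hu
    simp only [a, LinearMap.comp_apply, scaleDeg_of_mem hu, map_smul]
  have hz : ∀ m : ℤ, ∀ u ∈ homog K d m, z u = (-(m : K))⁻¹ • top d (l (slH K) (lev d 0 u)) := by
    intro m u hu
    simp only [z, LinearMap.comp_apply, scaleDeg_of_mem hu, map_smul]
  -- The values of `l` at highest weight vectors.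
  have key : ∀ m : ℤ, 0 ≤ m → ∀ u ∈ homog K d m,
      a u ∈ homog K d (m + 2) ∧ z u ∈ homog K d m ∧ b u ∈ homog K d (m - 2) ∧
      l (slE K) (lev d 0 u) = ((m + 1) * (m + 2)) • lev d 0 (a u) ∧
      l (slH K) (lev d 0 u) = (2 * (m + 1)) • lev d 1 (a u) - m • lev d 0 (z u) ∧
      l (slF K) (lev d 0 u) = lev d 2 (a u) - lev d 1 (z u) + lev d 0 (b u) := by
    intro m hm u hu
    have h1 : (m : K) + 1 ≠ 0 := by exact_mod_cast (show m + 1 ≠ 0 by omega)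
    have h2 : (m : K) + 2 ≠ 0 := by exact_mod_cast (show m + 2 ≠ 0 by omega)
    have re0 : rightAction K d (slE K) (lev d 0 u) = 0 := by rw [right_e hu]; simp
    have rh0 : rightAction K d (slH K) (lev d 0 u) = m • lev d 0 u := by rw [right_h hu]; simp
    have hA := highest_weight (n := m + 2) (y := l (slE K) (lev d 0 u))
      (by rw [hr, re0, lie_self, map_zero, map_zero, LinearMap.zero_apply, add_zero])
      (by rw [hr, rh0, lie_e_h, map_zsmul, map_smul, LinearMap.smul_apply]; module)
    have hau : a u ∈ homog K d (m + 2) := by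
      rw [ha m u hu]; exact Submodule.smul_mem _ _ hA.1
    have hle : l (slE K) (lev d 0 u) = ((m + 1) * (m + 2)) • lev d 0 (a u) := by
      have h3 : ((m + 1) * (m + 2)) • a u = top d (l (slE K) (lev d 0 u)) := by
        rw [ha m u hu, ← Int.cast_smul_eq_zsmul K, smul_smul]
        push_cast
        rw [mul_inv_cancel₀ (mul_ne_zero h1 h2), one_smul]
      rw [← map_zsmul, h3, hA.2]
    have rhlh : rightAction K d (slH K) (l (slH K) (lev d 0 u)) = m • l (slH K) (lev d 0 u) := by
      rw [hr, rh0, lie_self, map_zsmul, map_zero, LinearMap.zero_apply, add_zero]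
    have relh : rightAction K d (slE K) (l (slH K) (lev d 0 u)) =
        -((2 * ((m + 1) * (m + 2))) • lev d 0 (a u)) := by
      rw [hr, re0, lie_h_e, map_zero, map_smul, LinearMap.smul_apply, hle]; module
    have rhlf : rightAction K d (slH K) (l (slF K) (lev d 0 u)) =
        (m - 2) • l (slF K) (lev d 0 u) := by
      rw [hr, rh0, lie_f_h, map_zsmul, map_smul, LinearMap.smul_apply]; module
    have relf : rightAction K d (slE K) (l (slF K) (lev d 0 u)) = -l (slH K) (lev d 0 u) := by
      rw [hr, re0, lie_f_e, map_zero, map_neg, LinearMap.neg_apply, zero_add]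
    have rea := right_e hau
    have rha := right_h hau
    have hY := highest_weight (n := m)
      (y := l (slH K) (lev d 0 u) - (2 * (m + 1)) • lev d 1 (a u))
      (by rw [map_sub, map_zsmul, relh, rea, sub_self]; module)
      (by rw [map_sub, map_zsmul, rhlh, rha]; module)
    have htY : top d (l (slH K) (lev d 0 u) - (2 * (m + 1)) • lev d 1 (a u)) =
        top d (l (slH K) (lev d 0 u)) := by
      rw [map_sub, map_zsmul, top_lev_of_ne one_ne_zero, smul_zero, sub_zero]
    rw [htY] at hY
    have hzu : z u ∈ homog K d m := by
      rw [hz m u hu]; exact Submodule.smul_mem _ _ hY.1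
    have hmz : (-m) • z u = top d (l (slH K) (lev d 0 u)) := by
      by_cases h0 : m = 0
      · -- A highest weight vector of weight zero is not in the image of `e`.
        subst h0
        rw [neg_zero, zero_smul]
        ext p
        by_cases hp : d p = 0
        · have h4 := right_e_apply_last (l (slF K) (lev d 0 u) - lev d 2 (a u)) p
          rw [map_sub, relf, rea] at h4
          have h5 : (⟨p, Fin.last _⟩ : Index d) = ⟨p, 0⟩ := by
            congr 1
            exact Fin.ext (by simp [hp])
          rw [h5] at h4
          have h6 := lev_apply_zero_of_ne (d := d) (i := 2 - 1) (by norm_num) (a u) p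
          simp only [Pi.sub_apply, Pi.neg_apply, Pi.smul_apply, h6, smul_zero, sub_zero,
            neg_eq_zero] at h4
          exact h4.symm
        · exact (hY.1 p (by exact_mod_cast hp)).symm
      · have h3 : -(m : K) ≠ 0 := neg_ne_zero.mpr (by exact_mod_cast h0)
        rw [hz m u hu, ← Int.cast_smul_eq_zsmul K, smul_smul]
        push_cast
        rw [mul_inv_cancel₀ h3, one_smul]
    have hlh : l (slH K) (lev d 0 u) = (2 * (m + 1)) • lev d 1 (a u) - m • lev d 0 (z u) := by
      have h3 := hY.2
      rw [← hmz, map_zsmul, eq_sub_iff_add_eq] at h3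
      rw [← h3]; module
    have hT := highest_weight (n := m - 2)
      (y := l (slF K) (lev d 0 u) - lev d 2 (a u) + lev d 1 (z u))
      (by
        rw [map_add, map_sub, relf, rea, right_e hzu, hlh, sub_self, show (2 : ℤ) - 1 = 1 by rfl]
        module)
      (by rw [map_add, map_sub, rhlf, rha, right_h hzu]; module)
    have htT : top d (l (slF K) (lev d 0 u) - lev d 2 (a u) + lev d 1 (z u)) = b u := by
      rw [map_add, map_sub, top_lev_of_ne one_ne_zero, top_lev_of_ne two_ne_zero]
      simp [b]
    rw [htT] at hT
    refine ⟨hau, hzu, hT.1, hle, hlh, ?_⟩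
    rw [hT.2]; abel
  have hg : IsGraded d a z b := by
    refine ⟨fun m u hu => ?_, fun m u hu => ?_, fun m u hu => ?_⟩ <;>
    rcases lt_or_ge m 0 with hm | hm
    · rw [eq_zero_of_mem_homog_of_neg hu hm, map_zero]; exact zero_mem _
    · exact (key m hm u hu).1
    · rw [eq_zero_of_mem_homog_of_neg hu hm, map_zero]; exact zero_mem _
    · exact (key m hm u hu).2.1
    · rw [eq_zero_of_mem_homog_of_neg hu hm, map_zero]; exact zero_mem _
    · exact (key m hm u hu).2.2.1
  refine ⟨a, z, b, hg, left_ext hl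
    (fun x y v => LinearMap.congr_fun (leftOf_mul_right hg x y) v) fun x m hm u hu => ?_⟩
  obtain ⟨-, -, -, he, hh, hf⟩ := key m hm u hu
  refine sl2_induction (P := fun x => l x (lev d 0 u) = leftOf d a z b x (lev d 0 u))
    ?_ ?_ ?_ (fun x y hx hy => ?_) (fun c x hx => ?_) x
  · rw [he, left_e hg hu le_rfl]; simp
  · rw [hf, left_f hg hu le_rfl]; simp
  · rw [hh, left_h hg hu le_rfl]; simp
  · rw [map_add, map_add, LinearMap.add_apply, LinearMap.add_apply, hx, hy]
  · rw [map_smul, map_smul, LinearMap.smul_apply, LinearMap.smul_apply, hx]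

end Classification

/-! ### The relations forced by the bimodule identities -/

section Relations

variable {K : Type*} [Field K] {k : ℕ} {d : Fin k → ℕ}

theorem leftOf_congr_diag {a z z' b : Module.End K (Fin k → K)} (hg : IsGraded d a z b)
    (hg' : IsGraded d a z' b) (h : ∀ m : ℤ, m ≠ 0 → ∀ u ∈ homog K d m, z u = z' u) :
    leftOf d a z b = leftOf d a z' b := by
  have key : ∀ m i : ℤ, 0 ≤ i → i ≤ m → ∀ u ∈ homog K d m, m = 0 ∧ i = 0 ∨ z u = z' u := by
    intro m i hi him u hu
    by_cases hm : m = 0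
    · exact Or.inl (by omega)
    · exact Or.inr (h m hm u hu)
  refine LinearMap.ext (sl2_induction ?_ ?_ ?_ (fun x y hx hy => ?_) (fun c x hx => ?_))
  · refine space_ext fun m i hi him u hu => ?_
    rw [left_e hg hu hi, left_e hg' hu hi]
    obtain ⟨-, rfl⟩ | h := key m i hi him u hu
    · simp
    · rw [h]
  · refine space_ext fun m i hi him u hu => ?_
    rw [left_f hg hu hi, left_f hg' hu hi]
    obtain ⟨rfl, rfl⟩ | h := key m i hi him u hu
    · rw [lev_eq_zero_of_lt (hg.diag 0 u hu) (by norm_num),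
        lev_eq_zero_of_lt (hg'.diag 0 u hu) (by norm_num)]
    · rw [h]
  · refine space_ext fun m i hi him u hu => ?_
    rw [left_h hg hu hi, left_h hg' hu hi]
    obtain ⟨rfl, rfl⟩ | h := key m i hi him u hu
    · simp
    · rw [h]
  · rw [map_add, map_add, hx, hy]
  · rw [map_smul, map_smul, hx]

/-- A linear map `f` factors as `f * g * f`. -/
theorem exists_mul_mul_eq_self {E : Type*} [AddCommGroup E] [Module K E] (f : Module.End K E) :
    ∃ g : Module.End K E, ∀ u, f (g (f u)) = f u := by
  obtain ⟨s, hs⟩ := f.rangeRestrict.exists_rightInverse_of_surjective f.range_rangeRestrict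
  obtain ⟨g, hg⟩ := LinearMap.exists_extend s
  refine ⟨g, fun u => ?_⟩
  have h1 : g (f u) = s (f.rangeRestrict u) := LinearMap.congr_fun hg (f.rangeRestrict u)
  have h2 := congrArg Subtype.val (LinearMap.congr_fun hs (f.rangeRestrict u))
  rw [h1]
  exact h2

variable [CharZero K]

/-- A bimodule structure extending the right action is `leftOf a z b` with `a`, `z`, `b` satisfying
the relations `IsZigzag`. On components of degree zero, where `z` does not influence the left
action, it is chosen as a projection with kernel `ker a`. -/
theorem exists_isZigzag {l : Sl2 K →ₗ[K] Module.End K (Space K d)}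
    (hl : IsBimodule l (rightAction K d)) :
    ∃ a z b : Module.End K (Fin k → K), IsGraded d a z b ∧ IsZigzag a z b ∧
      l = leftOf d a z b := by
  obtain ⟨a, z, b, hg, rfl⟩ := exists_eq_leftOf hl.left_right
  have rel : ∀ x y v, top d (leftOf d a z b x (leftOf d a z b y v + rightAction K d y v)) = 0 := by
    intro x y v
    rw [map_add, hl.left_right, hl.left_left, sub_add_sub_cancel, sub_self, map_zero]
  -- The top coefficients of `[x, [y, v] + [v, y]] = 0` for a highest weight vector `v`.
  have key : ∀ m : ℤ, 0 ≤ m → ∀ u ∈ homog K d m, z (a u) = 0 ∧ m • (z (z u) - z u) = 0 ∧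
      m • (a u - a (z u)) = 0 ∧ m • (b u - b (z u)) = 0 ∧ (m - 2) • z (b u) = 0 ∧
      (m * (m - 1)) • a (b u) = 0 := by
    intro m hm u hu
    have n1 : m + 1 ≠ 0 := by omega
    have n2 : m + 2 ≠ 0 := by omega
    have he := rel (slH K) (slE K) (lev d 0 u)
    have fe := rel (slF K) (slE K) (lev d 0 u)
    have eh := rel (slE K) (slH K) (lev d 0 u)
    have hh := rel (slH K) (slH K) (lev d 0 u)
    have fh := rel (slF K) (slH K) (lev d 0 u)
    have ef := rel (slE K) (slF K) (lev d 0 u)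
    have hf := rel (slH K) (slF K) (lev d 0 u)
    have e0 := fun j (hj : 0 ≤ j) => left_e (i := j) hg hu hj
    have f0 := fun j (hj : 0 ≤ j) => left_f (i := j) hg hu hj
    have h0 := fun j (hj : 0 ≤ j) => left_h (i := j) hg hu hj
    have ea := fun j (hj : 0 ≤ j) => left_e (i := j) hg (hg.up m u hu) hj
    have fa := fun j (hj : 0 ≤ j) => left_f (i := j) hg (hg.up m u hu) hj
    have ha := fun j (hj : 0 ≤ j) => left_h (i := j) hg (hg.up m u hu) hj
    have ez := fun j (hj : 0 ≤ j) => left_e (i := j) hg (hg.diag m u hu) hj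
    have fz := fun j (hj : 0 ≤ j) => left_f (i := j) hg (hg.diag m u hu) hj
    have hz := fun j (hj : 0 ≤ j) => left_h (i := j) hg (hg.diag m u hu) hj
    have eb := fun j (hj : 0 ≤ j) => left_e (i := j) hg (hg.down m u hu) hj
    have hb := fun j (hj : 0 ≤ j) => left_h (i := j) hg (hg.down m u hu) hj
    have re0 := right_e hu
    have rh0 := right_h hu
    simp (disch := omega) only [map_add, map_sub, map_zsmul, e0, f0, h0, re0, ea, fa, ha,
      ez, fz, hz, eb, hb, rh0, right_f, add_zero, zero_mul, mul_zero, smul_zero,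
      Int.reduceSub, Int.reduceAdd, zero_add, sub_zero, zero_sub, neg_zero, top_lev_zero,
      top_lev_of_ne, sub_self, lev_eq_zero_of_neg] at he fe eh hh fh ef hf
    have hza : z (a u) = 0 := by
      rw [smul_eq_zero, neg_eq_zero, smul_eq_zero] at he
      exact (he.resolve_left (mul_ne_zero n1 n2)).resolve_left n2
    have hba : b (a u) = 0 := by
      rw [smul_eq_zero] at fe
      exact fe.resolve_left (mul_ne_zero n1 n2)
    rw [hza] at eh
    rw [hba] at hh ef
    have hzz : m • (z (z u) - z u) = 0 := by
      have h1 : m • (m • (z (z u) - z u)) = 0 := by rw [← hh]; module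
      rw [smul_eq_zero] at h1
      obtain h0 | h1 := h1
      · rw [h0, zero_smul]
      · exact h1
    refine ⟨hza, hzz, ?_, ?_, ?_, ?_⟩
    · have h1 : ((m + 1) * (m + 2)) • (m • (a u - a (z u))) = 0 := by rw [← eh]; module
      rw [smul_eq_zero] at h1
      exact h1.resolve_left (mul_ne_zero n1 n2)
    · rw [← fh]; module
    · by_cases h0 : m = 0
      · subst h0
        rw [eq_zero_of_mem_homog_of_neg (hg.down 0 u hu) (by norm_num), map_zero, smul_zero]
      · have h1 : m • (b u - b (z u)) = 0 := by rw [← fh]; module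
        rw [smul_eq_zero, sub_eq_zero] at h1
        rw [← h1.resolve_left h0] at hf
        rw [← neg_eq_zero, ← hf]; module
    · have h1 : (m * (m - 1)) • a (b u) = m • (z (z u) - z u) := by
        rw [← sub_eq_zero, ← ef]; module
      rw [h1, hzz]
  have hab : ∀ m : ℤ, ∀ u ∈ homog K d m, a (b u) = 0 := by
    intro m u hu
    rcases lt_or_ge m 2 with hm | hm
    · rw [eq_zero_of_mem_homog_of_neg (hg.down m u hu) (by omega), map_zero]
    · have h := (key m (by omega) u hu).2.2.2.2.2
      rw [smul_eq_zero] at h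
      exact h.resolve_left (mul_ne_zero (by omega) (by omega))
  -- A projection of the degree-zero part with kernel `ker a`, from a generalized inverse of `a`.
  set P : Module.End K (Fin k → K) := projDeg d 0
  have hP0 : ∀ u ∈ homog K d 0, P u = u := fun u hu => projDeg_of_mem hu
  have hPm : ∀ m : ℤ, m ≠ 0 → ∀ u ∈ homog K d m, P u = 0 := fun m hm u hu =>
    projDeg_of_mem_of_ne hm hu
  have hPh : ∀ u, P u ∈ homog K d 0 := projDeg_mem 0
  obtain ⟨g, hgi⟩ := exists_mul_mul_eq_self (a * P)
  simp only [Module.End.mul_apply] at hgi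
  let z' : Module.End K (Fin k → K) := z * (1 - P) + P * g * (a * P)
  have hz'm : ∀ m : ℤ, m ≠ 0 → ∀ u ∈ homog K d m, z' u = z u := fun m hm u hu => by
    simp only [z', LinearMap.add_apply, Module.End.mul_apply, LinearMap.sub_apply,
      Module.End.one_apply, hPm m hm u hu, map_zero, sub_zero, add_zero]
  have hz'0 : ∀ u ∈ homog K d 0, z' u = P (g (a u)) := fun u hu => by
    simp only [z', LinearMap.add_apply, Module.End.mul_apply, LinearMap.sub_apply,
      Module.End.one_apply, hP0 u hu, sub_self, map_zero, zero_add]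
  have hg' : IsGraded d a z' b := by
    refine ⟨hg.up, fun m u hu => ?_, hg.down⟩
    by_cases hm : m = 0
    · subst hm
      rw [hz'0 u hu]
      exact hPh _
    · rw [hz'm m hm u hu]
      exact hg.diag m u hu
  refine ⟨a, z', b, hg', ⟨?_, ?_, ?_, ?_, ?_⟩,
    leftOf_congr_diag hg hg' fun m hm u hu => (hz'm m hm u hu).symm⟩
  · refine fun u => LinearMap.congr_fun (f := z' * z')
      (linearMap_ext_homog (d := d) fun m hm u hu => ?_) u
    rw [Module.End.mul_apply]
    by_cases h0 : m = 0
    · subst h0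
      have h1 := hgi u
      rw [hP0 u hu] at h1
      rw [hz'0 _ (hg'.diag 0 u hu), hz'0 u hu, h1]
    · have h1 := (key m hm u hu).2.1
      rw [smul_eq_zero, sub_eq_zero] at h1
      rw [hz'm m h0 _ (hg'.diag m u hu), hz'm m h0 u hu, h1.resolve_left h0]
  · refine fun u => LinearMap.congr_fun (f := a * z')
      (linearMap_ext_homog (d := d) fun m hm u hu => ?_) u
    rw [Module.End.mul_apply]
    by_cases h0 : m = 0
    · subst h0
      have h1 := hgi u
      rw [hP0 u hu] at h1
      rw [hz'0 u hu, h1]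
    · have h1 := (key m hm u hu).2.2.1
      rw [smul_eq_zero, sub_eq_zero] at h1
      rw [hz'm m h0 u hu, h1.resolve_left h0]
  · refine fun u => LinearMap.congr_fun (f := z' * a) (g := 0)
      (linearMap_ext_homog (d := d) fun m hm u hu => ?_) u
    rw [Module.End.mul_apply, hz'm (m + 2) (by omega) _ (hg.up m u hu), (key m hm u hu).1,
      LinearMap.zero_apply]
  · refine fun u => LinearMap.congr_fun (f := b * z')
      (linearMap_ext_homog (d := d) fun m hm u hu => ?_) u
    rw [Module.End.mul_apply]
    by_cases h0 : m = 0
    · subst h0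
      rw [eq_zero_of_mem_homog_of_neg (hg.down 0 _ (hg'.diag 0 u hu)) (by norm_num),
        eq_zero_of_mem_homog_of_neg (hg.down 0 u hu) (by norm_num)]
    · have h1 := (key m hm u hu).2.2.2.1
      rw [smul_eq_zero, sub_eq_zero] at h1
      rw [hz'm m h0 u hu, h1.resolve_left h0]
  · refine fun u => LinearMap.congr_fun (f := z' * b) (g := 0)
      (linearMap_ext_homog (d := d) fun m hm u hu => ?_) u
    rw [Module.End.mul_apply, LinearMap.zero_apply]
    by_cases h2 : m = 2
    · subst h2
      rw [hz'0 _ (hg.down 2 u hu), hab 2 u hu, map_zero, map_zero]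
    · have h1 := (key m hm u hu).2.2.2.2.1
      rw [smul_eq_zero] at h1
      rw [hz'm (m - 2) (by omega) _ (hg.down m u hu), h1.resolve_left (by omega)]

end Relations

/-! ### Splitting off a zigzag -/

section Zigzag

variable {K : Type*} [Field K] {k : ℕ} {d : Fin k → ℕ}

/-- In a chain of components numbered `0, 1, 2, …`, those on which the left action does not vanish
alternate; `IsSource c p` says that `p` is one of them. The shift by one matches the numbering of
`leftAction`. -/
abbrev IsSource (c : ℤ) (p : ℕ) : Prop := (p : ℤ) + 1 ≡ c [ZMOD 2]

theorem isSource_pred (c : ℤ) (p : ℕ) : IsSource (c - 1) p ↔ IsSource c (p + 1) := by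
  simp only [IsSource, Int.ModEq, Nat.cast_add, Nat.cast_one]
  omega

theorem isSource_succ (c : ℤ) (p : ℕ) : IsSource c (p + 1) ↔ ¬ IsSource c p := by
  simp only [IsSource, Int.ModEq, Nat.cast_add, Nat.cast_one]
  omega

/-- The vectors of degree `n` which belong to the range of the idempotent `z` if `s` holds, and to
its kernel otherwise. -/
def part (d : Fin k → ℕ) (z : Module.End K (Fin k → K)) (n : ℤ) (s : Prop) [Decidable s] :
    Submodule K (Fin k → K) :=
  homog K d n ⊓ (if s then LinearMap.ker (1 - z) else LinearMap.ker z)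

theorem mem_part_pos {z : Module.End K (Fin k → K)} {n : ℤ} {s : Prop} [Decidable s] (hs : s)
    {u : Fin k → K} : u ∈ part d z n s ↔ u ∈ homog K d n ∧ z u = u := by
  rw [part, Submodule.mem_inf, if_pos hs, LinearMap.mem_ker, LinearMap.sub_apply, sub_eq_zero,
    Module.End.one_apply, eq_comm (a := u)]

theorem mem_part_neg {z : Module.End K (Fin k → K)} {n : ℤ} {s : Prop} [Decidable s] (hs : ¬ s)
    {u : Fin k → K} : u ∈ part d z n s ↔ u ∈ homog K d n ∧ z u = 0 := by
  rw [part, Submodule.mem_inf, if_neg hs, LinearMap.mem_ker]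

/-- A chain of `j` nonzero vectors `x 0, x 1, …` of degrees `n, n - 2, …`, linked by `a` and `b` in
the same way as the coordinate vectors of a model bimodule, together with a chain of linear forms
`y 0, y 1, …` which satisfy the transposed relations. Such data are a map from a model into the
multiplicity space and a map back. The relation for `b` into the top component is missing, since
the component above the chain is not taken into account. -/
structure Splitting (d : Fin k → ℕ) (a z b : Module.End K (Fin k → K)) (n : ℕ) (c : ℤ) (j : ℕ)
    (x : ℕ → Fin k → K) (y : ℕ → (Fin k → K) →ₗ[K] K) : Prop where
  pos : 0 < j
  le : ∀ p < j, 2 * p ≤ n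
  vec_mem : ∀ p : ℕ, x p ∈ homog K d ((n : ℤ) - 2 * p)
  vec_zero : ∀ p, j ≤ p → x p = 0
  vec_diag : ∀ p, z (x p) = if IsSource c p then x p else 0
  vec_down : ∀ p, b (x p) = if IsSource c p then x (p + 1) else 0
  vec_up : ∀ p, p + 1 < j → a (x (p + 1)) = if IsSource c (p + 1) then x p else 0
  form_of_ne : ∀ p : ℕ, ∀ m : ℤ, m ≠ (n : ℤ) - 2 * p → ∀ u ∈ homog K d m, y p u = 0
  form_zero : ∀ p, j ≤ p → y p = 0
  form_diag : ∀ p u, y p (z u) = if IsSource c p then y p u else 0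
  form_up : ∀ p u, y p (a u) = if IsSource c (p + 1) then y (p + 1) u else 0
  form_down : ∀ p, p + 1 < j → ∀ u, y (p + 1) (b u) = if IsSource c p then y p u else 0
  form_vec : y 0 (x 0) = 1

variable {a z b : Module.End K (Fin k → K)}

theorem projDeg_up (hg : IsGraded d a z b) (n : ℤ) (u : Fin k → K) :
    projDeg d (n + 2) (a u) = a (projDeg d n u) := by
  refine LinearMap.congr_fun (f := projDeg d (n + 2) * a) (g := a * projDeg d n)
    (linearMap_ext_homog (d := d) fun m _ u hu => ?_) u
  rw [Module.End.mul_apply, Module.End.mul_apply]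
  by_cases h : m = n
  · subst h
    rw [projDeg_of_mem (hg.up m u hu), projDeg_of_mem hu]
  · rw [projDeg_of_mem_of_ne (by omega) (hg.up m u hu), projDeg_of_mem_of_ne h hu, map_zero]

namespace Splitting

variable {n j : ℕ} {c : ℤ} {x : ℕ → Fin k → K} {y : ℕ → (Fin k → K) →ₗ[K] K}

theorem form_projDeg (hs : Splitting d a z b n c j x y) (p : ℕ) (u : Fin k → K) :
    y p (projDeg d ((n : ℤ) - 2 * p) u) = y p u := by
  refine LinearMap.congr_fun (f := y p ∘ₗ projDeg d ((n : ℤ) - 2 * p))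
    (linearMap_ext_homog (d := d) fun m _ u hu => ?_) u
  rw [LinearMap.comp_apply]
  by_cases h : m = (n : ℤ) - 2 * p
  · subst h
    rw [projDeg_of_mem hu]
  · rw [projDeg_of_mem_of_ne h hu, map_zero, hs.form_of_ne p m h u hu]

/-- Extend a chain by a new top component. -/
theorem cons (hs : Splitting d a z b n (c - 1) j x y) {x₀ : Fin k → K} {y₀ : (Fin k → K) →ₗ[K] K}
    (h_mem : x₀ ∈ homog K d ((n : ℤ) + 2)) (h_diag : z x₀ = if IsSource c 0 then x₀ else 0)
    (h_down : b x₀ = if IsSource c 0 then x 0 else 0)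
    (h_up : a (x 0) = if IsSource c 1 then x₀ else 0)
    (hy_of_ne : ∀ m : ℤ, m ≠ (n : ℤ) + 2 → ∀ u ∈ homog K d m, y₀ u = 0)
    (hy_diag : ∀ u, y₀ (z u) = if IsSource c 0 then y₀ u else 0)
    (hy_up : ∀ u, y₀ (a u) = if IsSource c 1 then y 0 u else 0)
    (hy_down : ∀ u, y 0 (b u) = if IsSource c 0 then y₀ u else 0) (h : y₀ x₀ = 1) :
    Splitting d a z b (n + 2) c (j + 1) (fun p => Nat.casesOn p x₀ x)
      (fun p => Nat.casesOn p y₀ y) where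
  pos := by omega
  le p hp := by
    cases p with
    | zero => omega
    | succ p => have := hs.le p (by omega); omega
  vec_mem p := by
    cases p with
    | zero => simpa using h_mem
    | succ p =>
      have := hs.vec_mem p
      rwa [show (n : ℤ) - 2 * p = ((n + 2 : ℕ) : ℤ) - 2 * ((p + 1 : ℕ) : ℤ) by push_cast; ring]
        at this
  vec_zero p hp := by
    cases p with
    | zero => omega
    | succ p => exact hs.vec_zero p (by omega)
  vec_diag p := by
    cases p with
    | zero => exact h_diag
    | succ p => simpa only [isSource_pred] using hs.vec_diag p
  vec_down p := by
    cases p with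
    | zero => exact h_down
    | succ p => simpa only [isSource_pred] using hs.vec_down p
  vec_up p hp := by
    cases p with
    | zero => exact h_up
    | succ p => simpa only [isSource_pred] using hs.vec_up p (by omega)
  form_of_ne p m hm u hu := by
    cases p with
    | zero => exact hy_of_ne m (by simpa using hm) u hu
    | succ p => exact hs.form_of_ne p m (by push_cast at hm; omega) u hu
  form_zero p hp := by
    cases p with
    | zero => omega
    | succ p => exact hs.form_zero p (by omega)
  form_diag p u := by
    cases p with
    | zero => exact hy_diag u
    | succ p => simpa only [isSource_pred] using hs.form_diag p u
  form_up p u := by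
    cases p with
    | zero => exact hy_up u
    | succ p => simpa only [isSource_pred] using hs.form_up p u
  form_down p hp u := by
    cases p with
    | zero => exact hy_down u
    | succ p => simpa only [isSource_pred] using hs.form_down p (by omega) u
  form_vec := h

/-- A chain with one component. -/
theorem single {x₀ : Fin k → K} {y₀ : (Fin k → K) →ₗ[K] K}
    (h_mem : x₀ ∈ homog K d n) (h_diag : z x₀ = if IsSource c 0 then x₀ else 0) (h_down : b x₀ = 0)
    (hy_of_ne : ∀ m : ℤ, m ≠ n → ∀ u ∈ homog K d m, y₀ u = 0)
    (hy_diag : ∀ u, y₀ (z u) = if IsSource c 0 then y₀ u else 0)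
    (hy_up : ∀ u, y₀ (a u) = 0) (h : y₀ x₀ = 1) :
    Splitting d a z b n c 1 (fun p => Nat.casesOn p x₀ 0) (fun p => Nat.casesOn p y₀ 0) where
  pos := one_pos
  le p hp := by omega
  vec_mem p := by
    cases p with
    | zero => simpa using h_mem
    | succ p => exact zero_mem _
  vec_zero p hp := by
    cases p with
    | zero => omega
    | succ p => rfl
  vec_diag p := by
    cases p with
    | zero => exact h_diag
    | succ p => simp
  vec_down p := by
    cases p with
    | zero => simpa using h_down
    | succ p => simp
  vec_up p hp := by omega
  form_of_ne p m hm u hu := by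
    cases p with
    | zero => exact hy_of_ne m (by simpa using hm) u hu
    | succ p => rfl
  form_zero p hp := by
    cases p with
    | zero => omega
    | succ p => rfl
  form_diag p u := by
    cases p with
    | zero => exact hy_diag u
    | succ p => simp
  form_up p u := by
    cases p with
    | zero => simpa using hy_up u
    | succ p => simp
  form_down p hp u := by omega
  form_vec := h

end Splitting

theorem exists_form_eq_one {E : Type*} [AddCommGroup E] [Module K E] {W : Submodule K E} {q : E}
    (hq : q ∉ W) : ∃ f : E →ₗ[K] K, f q = 1 ∧ ∀ w ∈ W, f w = 0 := by
  obtain ⟨f, hf, hW⟩ := Submodule.exists_le_ker_of_notMem hq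
  refine ⟨(f q)⁻¹ • f, by simp [hf], fun w hw => ?_⟩
  have : f w = 0 := hW hw
  simp [this]

/-- A linear form `g` on the source of `f` which vanishes on the preimage of `W` extends along `f`
to a linear form vanishing on `W`. -/
theorem exists_form_comp_eq {E F : Type*} [AddCommGroup E] [Module K E] [AddCommGroup F]
    [Module K F] (f : E →ₗ[K] F) (W : Submodule K F) (g : E →ₗ[K] K)
    (h : ∀ u, f u ∈ W → g u = 0) : ∃ φ : F →ₗ[K] K, (∀ u, φ (f u) = g u) ∧ ∀ w ∈ W, φ w = 0 := by
  have hg : g ∈ LinearMap.range (W.mkQ ∘ₗ f).dualMap := by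
    rw [LinearMap.range_dualMap_eq_dualAnnihilator_ker, Submodule.mem_dualAnnihilator]
    intro u hu
    rw [LinearMap.mem_ker, LinearMap.comp_apply, Submodule.mkQ_apply,
      Submodule.Quotient.mk_eq_zero] at hu
    exact h u hu
  obtain ⟨φ, hφ⟩ := hg
  refine ⟨φ ∘ₗ W.mkQ, fun u => LinearMap.congr_fun hφ u, fun w hw => ?_⟩
  rw [LinearMap.comp_apply, Submodule.mkQ_apply, (Submodule.Quotient.mk_eq_zero W).mpr hw, map_zero]

/-- Below any pair `W < Q` of subspaces of a part there is a chain whose first vector lies in `Q`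
and whose first linear form vanishes on `W`. At a source, the pair is pushed forward along `b`
unless a vector of `Q` outside `W` is killed by `b`; at a sink, it is pulled back along `a` unless
a vector of `Q` is outside the sum of `W` and the image of `a`. In the exceptional cases the chain
stops. -/
theorem exists_splitting (hg : IsGraded d a z b) (hz : IsZigzag a z b) (n : ℕ) :
    ∀ (c : ℤ) (W Q : Submodule K (Fin k → K)), W ≤ Q → Q ≤ part d z n (IsSource c 0) →
      ¬ Q ≤ W → ∃ j x y, Splitting d a z b n c j x y ∧ x 0 ∈ Q ∧ ∀ w ∈ W, y 0 w = 0 := by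
  induction n using Nat.strong_induction_on with
  | _ n ih =>
  intro c W Q hWQ hQ hne
  obtain ⟨q₀, hq₀, hq₀W⟩ := Set.not_subset.mp hne
  by_cases hs : IsSource c 0
  · have hs1 : ¬ IsSource c 1 := fun h => (isSource_succ c 0).mp h hs
    have hQ' : ∀ q ∈ Q, q ∈ homog K d n ∧ z q = q := fun q hq => (mem_part_pos hs).mp (hQ hq)
    by_cases h_end : ∃ q ∈ Q, q ∉ W ∧ b q = 0
    · obtain ⟨q, hq, hqW, hbq⟩ := h_end
      obtain ⟨f, hfq, hfW⟩ := exists_form_eq_one hqW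
      have hf : ∀ q ∈ Q, (f ∘ₗ projDeg d n ∘ₗ z) q = f q := fun q hq => by
        rw [LinearMap.comp_apply, LinearMap.comp_apply, (hQ' q hq).2,
          projDeg_of_mem (hQ' q hq).1]
      refine ⟨1, _, _, Splitting.single (x₀ := q) (y₀ := f ∘ₗ projDeg d n ∘ₗ z) (hQ' q hq).1
        (by rw [if_pos hs, (hQ' q hq).2]) hbq (fun m hm u hu => ?_) (fun u => ?_) (fun u => ?_)
        (by rw [hf q hq, hfq]), hq, fun w hw => (hf w (hWQ hw)).trans (hfW w hw)⟩
      · rw [LinearMap.comp_apply, LinearMap.comp_apply,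
          projDeg_of_mem_of_ne hm (hg.diag m u hu), map_zero]
      · rw [if_pos hs, LinearMap.comp_apply, LinearMap.comp_apply, hz.diag_diag]; rfl
      · rw [LinearMap.comp_apply, LinearMap.comp_apply, hz.diag_up, map_zero, map_zero]
    · push Not at h_end
      have hn : 2 ≤ n := by
        by_contra hn
        exact h_end q₀ hq₀ hq₀W
          (eq_zero_of_mem_homog_of_neg (hg.down n q₀ (hQ' q₀ hq₀).1) (by omega))
      obtain ⟨n, rfl⟩ := Nat.exists_eq_add_of_le' hn
      have hcast : (((n + 2 : ℕ) : ℤ)) - 2 = n := by push_cast; ring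
      obtain ⟨j, x, y, hsp, hx, hy⟩ := ih n (by omega) (c - 1) (W.map b) (Q.map b)
        (Submodule.map_mono hWQ)
        (by
          rintro _ ⟨q, hq, rfl⟩
          refine (mem_part_neg (by rwa [isSource_pred])).mpr ⟨?_, hz.diag_down q⟩
          have := hg.down _ q (hQ' q hq).1
          rwa [hcast] at this)
        (fun h => by
          obtain ⟨w, hw, hwq⟩ := h (Submodule.mem_map_of_mem hq₀)
          refine h_end (q₀ - w) (Q.sub_mem hq₀ (hWQ hw)) (fun h' => hq₀W ?_) (by
            rw [map_sub, hwq, sub_self])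
          simpa using W.add_mem h' hw)
      obtain ⟨q, hq, hqx⟩ := hx
      have hx0 : z (x 0) = 0 := by
        rw [hsp.vec_diag, if_neg (by rwa [isSource_pred])]
      refine ⟨j + 1, _, _, hsp.cons (x₀ := q) (y₀ := y 0 ∘ₗ b) (by simpa using (hQ' q hq).1)
        (by rw [if_pos hs, (hQ' q hq).2]) (by rw [if_pos hs, hqx])
        (by rw [if_neg hs1, ← hz.up_diag, hx0, map_zero]) (fun m hm u hu => ?_) (fun u => ?_)
        (fun u => ?_) (fun u => ?_) ?_, hq, fun w hw => hy _ (Submodule.mem_map_of_mem hw)⟩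
      · exact hsp.form_of_ne 0 (m - 2) (by push_cast; omega) _ (hg.down m u hu)
      · rw [if_pos hs, LinearMap.comp_apply, hz.down_diag]; rfl
      · rw [if_neg hs1, LinearMap.comp_apply, hz.down_up, map_zero]
      · rw [if_pos hs]; rfl
      · rw [LinearMap.comp_apply, hqx, hsp.form_vec]
  · have hs1 : IsSource c 1 := (isSource_succ c 0).mpr hs
    have hQ' : ∀ q ∈ Q, q ∈ homog K d n ∧ z q = 0 := fun q hq => (mem_part_neg hs).mp (hQ hq)
    have hf : ∀ f : (Fin k → K) →ₗ[K] K, ∀ q ∈ Q, (f ∘ₗ projDeg d n ∘ₗ (1 - z)) q = f q := by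
      intro f q hq
      rw [LinearMap.comp_apply, LinearMap.comp_apply, LinearMap.sub_apply, (hQ' q hq).2, sub_zero,
        Module.End.one_apply, projDeg_of_mem (hQ' q hq).1]
    have hf_ne : ∀ f : (Fin k → K) →ₗ[K] K, ∀ m : ℤ, m ≠ n → ∀ u ∈ homog K d m,
        (f ∘ₗ projDeg d n ∘ₗ (1 - z)) u = 0 := by
      intro f m hm u hu
      rw [LinearMap.comp_apply, LinearMap.comp_apply, LinearMap.sub_apply, Module.End.one_apply,
        projDeg_of_mem_of_ne hm (sub_mem hu (hg.diag m u hu)), map_zero]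
    have hf_diag : ∀ f : (Fin k → K) →ₗ[K] K, ∀ u,
        (f ∘ₗ projDeg d n ∘ₗ (1 - z)) (z u) = 0 := by
      intro f u
      rw [LinearMap.comp_apply, LinearMap.comp_apply, LinearMap.sub_apply, hz.diag_diag,
        Module.End.one_apply, sub_self, map_zero, map_zero]
    have hf_up : ∀ f : (Fin k → K) →ₗ[K] K, ∀ u,
        (f ∘ₗ projDeg d n ∘ₗ (1 - z)) (a u) = f (a (z (projDeg d ((n : ℤ) - 2) u))) := by
      intro f u
      rw [LinearMap.comp_apply, LinearMap.comp_apply, LinearMap.sub_apply, hz.diag_up,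
        Module.End.one_apply, sub_zero, hz.up_diag, ← projDeg_up hg, sub_add_cancel]
    have hzp : ∀ u, z (projDeg d ((n : ℤ) - 2) u) ∈ part d z ((n : ℤ) - 2) True := fun u =>
      (mem_part_pos trivial).mpr ⟨hg.diag _ _ (projDeg_mem _ u), hz.diag_diag _⟩
    by_cases h_end : ∃ q ∈ Q, q ∉ W ⊔ (part d z ((n : ℤ) - 2) True).map a
    · obtain ⟨q, hq, hqW⟩ := h_end
      obtain ⟨f, hfq, hfW⟩ := exists_form_eq_one hqW
      refine ⟨1, _, _, Splitting.single (x₀ := q) (y₀ := f ∘ₗ projDeg d n ∘ₗ (1 - z)) (hQ' q hq).1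
        (by rw [if_neg hs, (hQ' q hq).2]) (by rw [← hz.down_diag, (hQ' q hq).2, map_zero])
        (hf_ne f) (fun u => by rw [if_neg hs, hf_diag]) (fun u => ?_)
        (by rw [hf f q hq, hfq]), hq, fun w hw =>
          (hf f w (hWQ hw)).trans (hfW w (Submodule.mem_sup_left hw))⟩
      rw [hf_up]
      exact hfW _ (Submodule.mem_sup_right (Submodule.mem_map_of_mem (hzp u)))
    · push Not at h_end
      obtain ⟨w, hw, _, ⟨t, ht, rfl⟩, hwt⟩ := Submodule.mem_sup.mp (h_end q₀ hq₀)
      have hn : 2 ≤ n := by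
        by_contra hn
        have ht0 := eq_zero_of_mem_homog_of_neg ((mem_part_pos trivial).mp ht).1 (by omega)
        rw [ht0, map_zero, add_zero] at hwt
        exact hq₀W (hwt ▸ hw)
      obtain ⟨n, rfl⟩ := Nat.exists_eq_add_of_le' hn
      have hcast : (((n + 2 : ℕ) : ℤ)) - 2 = n := by push_cast; ring
      rw [hcast] at ht hzp hf_up
      have hs1' : IsSource (c - 1) 0 := (isSource_pred c 0).mpr hs1
      obtain ⟨j, x, y, hsp, hx, hy⟩ := ih n (by omega) (c - 1)
        (part d z n True ⊓ W.comap a) (part d z n True ⊓ Q.comap a)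
        (inf_le_inf_left _ (Submodule.comap_mono hWQ))
        (fun u hu => (mem_part_pos hs1').mpr ((mem_part_pos trivial).mp hu.1))
        (fun h => by
          have hat : a t = q₀ - w := by rw [← hwt, add_sub_cancel_left]
          have ht' : a t ∈ W := (h ⟨ht, by
            change a t ∈ Q
            rw [hat]; exact Q.sub_mem hq₀ (hWQ hw)⟩).2
          exact hq₀W (hwt ▸ W.add_mem hw ht'))
      have hy_diag : ∀ u, y 0 (z u) = y 0 u := fun u => by rw [hsp.form_diag, if_pos hs1']
      have hy_proj : ∀ u, y 0 (z (projDeg d n u)) = y 0 u := fun u => by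
        have := hsp.form_projDeg 0 u
        rw [Nat.cast_zero, mul_zero, sub_zero] at this
        rw [hy_diag, this]
      obtain ⟨f, hfa, hfW⟩ := exists_form_comp_eq a W (y 0) (fun u hu => by
        rw [← hy_proj]
        refine hy _ ⟨hzp u, ?_⟩
        change a (z (projDeg d n u)) ∈ W
        have h1 : projDeg d ((n : ℤ) + 2) (a u) = a u :=
          projDeg_of_mem (by simpa using (hQ' _ (hWQ hu)).1)
        rwa [hz.up_diag, ← projDeg_up hg, h1])
      refine ⟨j + 1, _, _, hsp.cons (x₀ := a (x 0))
        (y₀ := f ∘ₗ projDeg d ((n + 2 : ℕ) : ℤ) ∘ₗ (1 - z))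
        (by simpa using hg.up _ _ (hsp.vec_mem 0)) (by rw [if_neg hs, hz.diag_up])
        (by rw [if_neg hs, hz.down_up]) (by rw [if_pos hs1]) (fun m hm u hu => ?_) (fun u => ?_)
        (fun u => ?_) (fun u => ?_) ?_, hx.2, fun w hw =>
          (hf f w (hWQ hw)).trans (hfW w hw)⟩
      · exact hf_ne f m (by push_cast; exact hm) u hu
      · rw [if_neg hs, hf_diag]
      · rw [if_pos hs1, hf_up, hfa, hy_proj]
      · rw [if_neg hs, ← hy_diag, hz.diag_down, map_zero]
      · rw [hf_up, hfa, hy_proj, hsp.form_vec]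

end Zigzag

/-! ### Homomorphisms of right modules -/

section Lift

variable {K : Type*} [Field K] {k k' : ℕ} {d : Fin k → ℕ} {d' : Fin k' → ℕ}

/-- The map `V(d'₁) ⊕ ⋯ → V(d₁) ⊕ ⋯` which acts as `g` on each level. It is a homomorphism of right
modules if `g` preserves degrees, and every homomorphism arises in this way. -/
noncomputable def lift (d' : Fin k' → ℕ) (d : Fin k → ℕ) (g : (Fin k' → K) →ₗ[K] (Fin k → K)) :
    Space K d' →ₗ[K] Space K d :=
  opOf fun i _ => lev d i ∘ₗ g

/-- A map of multiplicity spaces which preserves degrees. -/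
def PreservesDegree (d' : Fin k' → ℕ) (d : Fin k → ℕ) (g : (Fin k' → K) →ₗ[K] (Fin k → K)) :
    Prop :=
  ∀ m : ℤ, ∀ u ∈ homog K d' m, g u ∈ homog K d m

variable {g : (Fin k' → K) →ₗ[K] (Fin k → K)}

theorem lift_lev (hg : PreservesDegree d' d g) {m : ℤ} {u : Fin k' → K} (hu : u ∈ homog K d' m)
    (i : ℤ) : lift d' d g (lev d' i u) = lev d i (g u) := by
  rcases lt_or_ge i 0 with hi | hi
  · rw [lev_eq_zero_of_neg hi, lev_eq_zero_of_neg hi, map_zero]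
  · exact opOf_lev hu hi fun v hv h => lev_eq_zero_of_lt (hg m v hv) h

theorem lift_right (hg : PreservesDegree d' d g) (x : Sl2 K) (v : Space K d') :
    lift d' d g (rightAction K d' x v) = rightAction K d x (lift d' d g v) := by
  refine LinearMap.congr_fun (f := lift d' d g ∘ₗ rightAction K d' x)
    (g := rightAction K d x ∘ₗ lift d' d g) (space_ext fun m i hi him u hu => ?_) v
  rw [LinearMap.comp_apply, LinearMap.comp_apply, lift_lev hg hu]
  refine sl2_induction (P := fun x => lift d' d g (rightAction K d' x (lev d' i u)) =
    rightAction K d x (lev d i (g u))) ?_ ?_ ?_ (fun x y hx hy => ?_) (fun c x hx => ?_) x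
  · rw [right_e hu, right_e (hg m u hu), map_zsmul, lift_lev hg hu]
  · rw [right_f hi, right_f hi, lift_lev hg hu]
  · rw [right_h hu, right_h (hg m u hu), map_zsmul, lift_lev hg hu]
  · rw [map_add, map_add, LinearMap.add_apply, LinearMap.add_apply, map_add, hx, hy]
  · rw [map_smul, map_smul, LinearMap.smul_apply, LinearMap.smul_apply, map_smul, hx]

variable {a z b : Module.End K (Fin k → K)} {a' z' b' : Module.End K (Fin k' → K)}

theorem lift_left (hg : PreservesDegree d' d g) (h' : IsGraded d' a' z' b')
    (h : IsGraded d a z b) (ha : ∀ u, g (a' u) = a (g u)) (hz : ∀ u, g (z' u) = z (g u))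
    (hb : ∀ u, g (b' u) = b (g u)) (x : Sl2 K) (v : Space K d') :
    lift d' d g (leftOf d' a' z' b' x v) = leftOf d a z b x (lift d' d g v) := by
  refine LinearMap.congr_fun (f := lift d' d g ∘ₗ leftOf d' a' z' b' x)
    (g := leftOf d a z b x ∘ₗ lift d' d g) (space_ext fun m i hi him u hu => ?_) v
  rw [LinearMap.comp_apply, LinearMap.comp_apply, lift_lev hg hu]
  have hu' := hg m u hu
  have lu := lift_lev hg (h'.up m u hu)
  have lz := lift_lev hg (h'.diag m u hu)
  have lb := lift_lev hg (h'.down m u hu)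
  refine sl2_induction (P := fun x => lift d' d g (leftOf d' a' z' b' x (lev d' i u)) =
    leftOf d a z b x (lev d i (g u))) ?_ ?_ ?_ (fun x y hx hy => ?_) (fun c x hx => ?_) x
  · rw [left_e h' hu hi, left_e h hu' hi]
    simp only [map_add, map_zsmul, lu, lz, lb, ha, hz, hb]
  · rw [left_f h' hu hi, left_f h hu' hi]
    simp only [map_add, map_sub, lu, lz, lb, ha, hz, hb]
  · rw [left_h h' hu hi, left_h h hu' hi]
    simp only [map_sub, map_zsmul, lu, lz, lb, ha, hz, hb]
  · rw [map_add, map_add, LinearMap.add_apply, LinearMap.add_apply, map_add, hx, hy]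
  · rw [map_smul, map_smul, LinearMap.smul_apply, LinearMap.smul_apply, map_smul, hx]

variable [CharZero K]

theorem exists_eq_lift {φ : Space K d' →ₗ[K] Space K d}
    (hφ : ∀ x v, φ (rightAction K d' x v) = rightAction K d x (φ v)) :
    ∃ g : (Fin k' → K) →ₗ[K] (Fin k → K), PreservesDegree d' d g ∧ φ = lift d' d g := by
  have key : ∀ m : ℤ, ∀ u ∈ homog K d' m, top d (φ (lev d' 0 u)) ∈ homog K d m ∧
      lev d 0 (top d (φ (lev d' 0 u))) = φ (lev d' 0 u) := by
    intro m u hu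
    refine highest_weight ?_ ?_
    · rw [← hφ, right_e hu, zero_mul, neg_zero, zero_smul, map_zero]
    · rw [← hφ, right_h hu, mul_zero, sub_zero, map_zsmul]
  have hg : PreservesDegree d' d (top d ∘ₗ φ ∘ₗ lev d' 0) := fun m u hu => (key m u hu).1
  refine ⟨top d ∘ₗ φ ∘ₗ lev d' 0, hg, space_ext fun m i hi _ u hu => ?_⟩
  rw [lift_lev hg hu]
  obtain ⟨j, rfl⟩ := Int.eq_ofNat_of_zero_le hi
  clear hi
  induction j with
  | zero => exact (key m u hu).2.symm
  | succ j ih =>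
    rw [Nat.cast_succ, ← right_f (by positivity), hφ, ih (by omega), right_f (by positivity)]

/-- Bimodule homomorphisms intertwine the maps of the multiplicity spaces, except for the diagonal
maps in degree zero, which do not influence the left actions. -/
theorem intertwines_of_lift (hg : PreservesDegree d' d g) (h' : IsGraded d' a' z' b')
    (h : IsGraded d a z b)
    (hl : ∀ x v, lift d' d g (leftOf d' a' z' b' x v) = leftOf d a z b x (lift d' d g v)) {m : ℤ}
    (hm : 0 ≤ m) {u : Fin k' → K} (hu : u ∈ homog K d' m) :
    g (a' u) = a (g u) ∧ m • g (z' u) = m • z (g u) ∧ g (b' u) = b (g u) := by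
  have hu' := hg m u hu
  have lu := lift_lev hg (h'.up m u hu)
  have lz := lift_lev hg (h'.diag m u hu)
  have lb := lift_lev hg (h'.down m u hu)
  have he := congrArg (top d) (hl (slE K) (lev d' 0 u))
  have hf := congrArg (top d) (hl (slF K) (lev d' 0 u))
  have hh := congrArg (top d) (hl (slH K) (lev d' 0 u))
  rw [lift_lev hg hu, left_e h' hu le_rfl, left_e h hu' le_rfl] at he
  rw [lift_lev hg hu, left_f h' hu le_rfl, left_f h hu' le_rfl] at hf
  rw [lift_lev hg hu, left_h h' hu le_rfl, left_h h hu' le_rfl] at hh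
  simp (disch := omega) only [map_add, map_sub, map_zsmul, lu, lz, lb, top_lev_zero, top_lev_of_ne,
    mul_zero, zero_mul, zero_smul, smul_zero, add_zero, sub_zero, zero_sub, zero_add,
    neg_inj] at he hf hh
  refine ⟨?_, hh, hf⟩
  have h1 : ((m + 1) * (m + 2)) • (g (a' u) - a (g u)) = 0 := by rw [smul_sub, he, sub_self]
  rw [smul_eq_zero, sub_eq_zero] at h1
  exact h1.resolve_left (mul_ne_zero (by omega) (by omega))

/-- The degrees can be recovered from the right module: an invertible map of the multiplicity
spaces has a nonzero term in its determinant, hence matches the degrees by a permutation. -/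
theorem eq_of_rightIso (hd : Antitone d) (hd' : Antitone d')
    (h : RightIso (rightAction K d') (rightAction K d)) :
    ∃ hk : k' = k, ∀ i : Fin k', d' i = d (Fin.cast hk i) := by
  obtain ⟨φ, hφ⟩ := h
  obtain ⟨g, hg, hgφ⟩ := exists_eq_lift (φ := φ.toLinearMap) hφ
  obtain ⟨g', hg', hgφ'⟩ := exists_eq_lift (φ := φ.symm.toLinearMap) (d := d') (d' := d)
    fun x v => by
      apply φ.injective
      simp [hφ]
  have h1 : g' ∘ₗ g = LinearMap.id := by
    refine linearMap_ext_homog (d := d') fun m _ u hu => lev_zero_injective (d := d') ?_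
    rw [LinearMap.comp_apply, ← lift_lev hg' (hg m u hu), ← lift_lev hg hu, ← hgφ, ← hgφ']
    simp
  have h2 : g ∘ₗ g' = LinearMap.id := by
    refine linearMap_ext_homog (d := d) fun m _ u hu => lev_zero_injective (d := d) ?_
    rw [LinearMap.comp_apply, ← lift_lev hg (hg' m u hu), ← lift_lev hg' hu, ← hgφ, ← hgφ']
    simp
  have e : (Fin k' → K) ≃ₗ[K] (Fin k → K) := LinearEquiv.ofLinearMap g g' h2 h1
  have hk : k' = k := by simpa using e.finrank_eq
  subst hk
  have hdet : (LinearMap.toMatrix' g).det ≠ 0 := by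
    intro h0
    have h3 := congrArg Matrix.det (LinearMap.toMatrix'_comp g' g)
    rw [h1, LinearMap.toMatrix'_id, Matrix.det_mul, h0, mul_zero, Matrix.det_one] at h3
    exact one_ne_zero h3
  rw [Matrix.det_apply] at hdet
  obtain ⟨σ, -, hσ⟩ := Finset.exists_ne_zero_of_sum_ne_zero hdet
  have hσ' : ∀ i, d (σ i) = d' i := by
    intro i
    by_contra hne
    apply hσ
    rw [Finset.prod_eq_zero (Finset.mem_univ i), smul_zero]
    rw [LinearMap.toMatrix'_apply]
    exact hg (d' i) _ (single_mem_homog i 1) (σ i) (by exact_mod_cast hne)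
  refine ⟨rfl, fun i => ?_⟩
  have h3 : d ∘ σ = d' := funext hσ'
  have h4 := Tuple.unique_antitone (f := d) (σ := σ) (τ := 1) (by rwa [h3]) hd
  rw [h3] at h4
  exact congrFun h4 i

end Lift

/-! ### The model bimodules -/

section Model

variable {K : Type*} [Field K] {k : ℕ}

/-- The `p`-th coordinate, which is zero for `p ≥ k`. -/
def coord (p : ℕ) : (Fin k → K) →ₗ[K] K where
  toFun u := if h : p < k then u ⟨p, h⟩ else 0
  map_add' u v := by by_cases h : p < k <;> simp [h]
  map_smul' c u := by by_cases h : p < k <;> simp [h]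

theorem coord_of_lt {p : ℕ} (h : p < k) (u : Fin k → K) : coord p u = u ⟨p, h⟩ := dif_pos h

theorem coord_of_le {p : ℕ} (h : k ≤ p) (u : Fin k → K) : coord p u = 0 := dif_neg (by omega)

theorem ext_coord {u v : Fin k → K} (h : ∀ p < k, coord p u = coord p v) : u = v := by
  ext p
  have := h p p.2
  rwa [coord_of_lt p.2, coord_of_lt p.2] at this

variable (K k) in
/-- The `p`-th coordinate vector, which is zero for `p ≥ k`. -/
def unit (p : ℕ) : Fin k → K := fun q => if (q : ℕ) = p then 1 else 0

theorem coord_unit {p q : ℕ} (hq : q < k) : coord q (unit K k p) = if q = p then 1 else 0 :=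
  coord_of_lt hq _

theorem single_eq_unit (p : Fin k) : Pi.single p (1 : K) = unit K k p := by
  ext q
  simp [Pi.single_apply, unit, Fin.ext_iff]

theorem unit_of_le {p : ℕ} (h : k ≤ p) : unit K k p = 0 := by
  ext q
  have := q.2
  rw [unit, if_neg (by omega)]
  rfl

theorem lev_unit {d : Fin k → ℕ} (p : ℕ) (i : ℤ) :
    lev d i (unit K k p) = vec K d ((p : ℤ) + 1) i := by
  ext a
  rw [lev_apply, unit, vec]
  by_cases h1 : (a.1 : ℕ) = p <;> by_cases h2 : ((a.2 : ℕ) : ℤ) = i <;> simp [h1, h2]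

theorem vec_zero_left {d : Fin k → ℕ} (i : ℤ) : vec K d 0 i = 0 := by
  ext a
  rw [vec, if_neg (by omega)]
  rfl

/-- Linear maps on the multiplicity space agree if they agree on the coordinate vectors. -/
theorem ext_unit {E : Type*} [AddCommGroup E] [Module K E] {f g : (Fin k → K) →ₗ[K] E}
    (h : ∀ p < k, f (unit K k p) = g (unit K k p)) : f = g :=
  (Pi.basisFun K (Fin k)).ext fun p => by
    rw [Pi.basisFun_apply, single_eq_unit]
    exact h p p.2

variable (K k) in
/-- The degree-raising map of the model bimodule: `p ↦ p - 1` on the sources. -/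
def modelUp (c : ℤ) : Module.End K (Fin k → K) where
  toFun u p := if IsSource c (p + 1) then coord (p + 1) u else 0
  map_add' u v := by ext p; by_cases h : IsSource c (p + 1) <;> simp [h]
  map_smul' t u := by ext p; by_cases h : IsSource c (p + 1) <;> simp [h]

variable (K k) in
/-- The diagonal map of the model bimodule: the projection onto the sources. -/
def modelDiag (c : ℤ) : Module.End K (Fin k → K) where
  toFun u p := if IsSource c p then u p else 0
  map_add' u v := by ext p; by_cases h : IsSource c p <;> simp [h]
  map_smul' t u := by ext p; by_cases h : IsSource c p <;> simp [h]

variable (K k) in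
/-- The degree-lowering map of the model bimodule: `p ↦ p + 1` on the sources. -/
def modelDown (c : ℤ) : Module.End K (Fin k → K) where
  toFun u p := if 0 < (p : ℕ) ∧ IsSource c (p - 1) then coord (p - 1) u else 0
  map_add' u v := by ext p; by_cases h : 0 < (p : ℕ) ∧ IsSource c (p - 1) <;> simp [h]
  map_smul' t u := by ext p; by_cases h : 0 < (p : ℕ) ∧ IsSource c (p - 1) <;> simp [h]

variable {c : ℤ}

theorem coord_modelUp {p : ℕ} (hp : p < k) (u : Fin k → K) :
    coord p (modelUp K k c u) = if IsSource c (p + 1) then coord (p + 1) u else 0 :=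
  coord_of_lt hp _

theorem coord_modelDiag (p : ℕ) (u : Fin k → K) :
    coord p (modelDiag K k c u) = if IsSource c p then coord p u else 0 := by
  by_cases hp : p < k
  · rw [coord_of_lt hp, coord_of_lt hp]; rfl
  · rw [coord_of_le (by omega), coord_of_le (by omega), ite_self]

theorem coord_zero_modelDown (u : Fin k → K) : coord 0 (modelDown K k c u) = 0 := by
  by_cases hp : 0 < k
  · rw [coord_of_lt hp]
    simp [modelDown]
  · exact coord_of_le (by omega) _

theorem coord_succ_modelDown {p : ℕ} (hp : p + 1 < k) (u : Fin k → K) :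
    coord (p + 1) (modelDown K k c u) = if IsSource c p then coord p u else 0 := by
  rw [coord_of_lt hp]
  simp [modelDown]

theorem modelUp_unit_zero : modelUp K k c (unit K k 0) = 0 := by
  refine ext_coord fun q hq => ?_
  rw [coord_modelUp hq, map_zero]
  split_ifs with h
  · by_cases hq' : q + 1 < k
    · rw [coord_unit hq', if_neg (by omega)]
    · exact coord_of_le (by omega) _
  · rfl

theorem modelUp_unit_succ {p : ℕ} (hp : p + 1 < k) : modelUp K k c (unit K k (p + 1)) =
    if IsSource c (p + 1) then unit K k p else 0 := by
  refine ext_coord fun q hq => ?_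
  rw [coord_modelUp hq]
  by_cases hq' : q = p
  · subst hq'
    rw [coord_unit hp, if_pos rfl]
    split_ifs with h
    · rw [coord_unit hq, if_pos rfl]
    · rw [map_zero]
  · have h1 : coord (q + 1) (unit K k (p + 1)) = 0 := by
      by_cases h : q + 1 < k
      · rw [coord_unit h, if_neg (by omega)]
      · exact coord_of_le (by omega) _
    rw [h1, ite_self]
    split_ifs with h
    · rw [coord_unit hq, if_neg hq']
    · rw [map_zero]

theorem modelDiag_unit (p : ℕ) : modelDiag K k c (unit K k p) =
    if IsSource c p then unit K k p else 0 := by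
  refine ext_coord fun q hq => ?_
  rw [coord_modelDiag, coord_unit hq]
  by_cases hq' : q = p
  · subst hq'
    rw [if_pos rfl]
    split_ifs with h
    · rw [coord_unit hq, if_pos rfl]
    · rw [map_zero]
  · rw [if_neg hq', ite_self]
    split_ifs with h
    · rw [coord_unit hq, if_neg hq']
    · rw [map_zero]

theorem modelDown_unit {p : ℕ} (hp : p < k) : modelDown K k c (unit K k p) =
    if IsSource c p then unit K k (p + 1) else 0 := by
  refine ext_coord fun q hq => ?_
  cases q with
  | zero =>
    rw [coord_zero_modelDown]
    split_ifs with h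
    · rw [coord_unit hq, if_neg (by omega)]
    · rw [map_zero]
  | succ q =>
    rw [coord_succ_modelDown hq, coord_unit (by omega)]
    by_cases hq' : q = p
    · subst hq'
      rw [if_pos rfl]
      split_ifs with h
      · rw [coord_unit hq, if_pos rfl]
      · rw [map_zero]
    · rw [if_neg hq', ite_self]
      split_ifs with h
      · rw [coord_unit hq, if_neg (by omega)]
      · rw [map_zero]

theorem isZigzag_model : IsZigzag (modelUp K k c) (modelDiag K k c) (modelDown K k c) where
  diag_diag u := ext_coord fun p hp => by
    rw [coord_modelDiag, coord_modelDiag]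
    split_ifs <;> rfl
  up_diag u := ext_coord fun p hp => by
    rw [coord_modelUp hp, coord_modelUp hp, coord_modelDiag]
    split_ifs <;> rfl
  diag_up u := ext_coord fun p hp => by
    rw [coord_modelDiag, coord_modelUp hp, map_zero]
    by_cases h : IsSource c p <;> simp [h, isSource_succ]
  down_diag u := ext_coord fun p hp => by
    cases p with
    | zero => rw [coord_zero_modelDown, coord_zero_modelDown]
    | succ p =>
      rw [coord_succ_modelDown hp, coord_succ_modelDown hp, coord_modelDiag]
      split_ifs <;> rfl
  diag_down u := ext_coord fun p hp => by
    rw [coord_modelDiag, map_zero]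
    cases p with
    | zero => rw [coord_zero_modelDown, ite_self]
    | succ p =>
      rw [coord_succ_modelDown hp]
      by_cases h : IsSource c p <;> simp [h, isSource_succ]

theorem mem_homog_chain {n : ℕ} (hn : 2 * (k - 1) ≤ n) {m : ℤ} {u : Fin k → K} :
    u ∈ homog K (chain n k) m ↔ ∀ p : ℕ, p < k → (n : ℤ) - 2 * p ≠ m → coord p u = 0 := by
  rw [mem_homog]
  refine ⟨fun h p hp hm => ?_, fun h p hm => ?_⟩
  · rw [coord_of_lt hp]
    refine h ⟨p, hp⟩ ?_
    simp only [chain]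
    omega
  · have hp := p.2
    refine (coord_of_lt hp u).symm.trans (h p hp ?_)
    simp only [chain] at hm
    omega

theorem unit_mem_homog_chain {n : ℕ} (hn : 2 * (k - 1) ≤ n) (p : ℕ) :
    unit K k p ∈ homog K (chain n k) ((n : ℤ) - 2 * p) := by
  rw [mem_homog_chain hn]
  intro q hq hne
  rw [coord_unit hq, if_neg]
  rintro rfl
  exact hne rfl

theorem isGraded_model {n : ℕ} (hn : 2 * (k - 1) ≤ n) :
    IsGraded (chain n k) (modelUp K k c) (modelDiag K k c) (modelDown K k c) := by
  refine ⟨fun m u hu => ?_, fun m u hu => ?_, fun m u hu => ?_⟩ <;>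
    rw [mem_homog_chain hn] at hu ⊢ <;> intro p hp hne
  · rw [coord_modelUp hp]
    split_ifs with h
    · by_cases hp' : p + 1 < k
      · exact hu (p + 1) hp' (by push_cast; omega)
      · exact coord_of_le (by omega) _
    · rfl
  · rw [coord_modelDiag, hu p hp hne, ite_self]
  · cases p with
    | zero => exact coord_zero_modelDown _
    | succ p =>
      rw [coord_succ_modelDown hp, hu p (by omega) (by push_cast at hne; omega), ite_self]

theorem leftAction_eq_leftOf (d : Fin k → ℕ) :
    leftAction K d c = leftOf d (modelUp K k c) (modelDiag K k c) (modelDown K k c) := by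
  have hup : ∀ (p : Fin k) (i : ℤ), lev d i (modelUp K k c (Pi.single p 1)) =
      if ((p : ℕ) : ℤ) + 1 ≡ c [ZMOD 2] then vec K d (((p : ℕ) : ℤ) + 1 - 1) i else 0 := by
    intro p i
    obtain ⟨p, hp⟩ := p
    rw [single_eq_unit]
    cases p with
    | zero => simp [modelUp_unit_zero, vec_zero_left]
    | succ p =>
      rw [modelUp_unit_succ hp]
      split_ifs with h
      · rw [lev_unit]; simp
      · rw [map_zero]
  have hdiag : ∀ (p : Fin k) (i : ℤ), lev d i (modelDiag K k c (Pi.single p 1)) =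
      if ((p : ℕ) : ℤ) + 1 ≡ c [ZMOD 2] then vec K d (((p : ℕ) : ℤ) + 1) i else 0 := by
    intro p i
    rw [single_eq_unit, modelDiag_unit]
    split_ifs with h
    · rw [lev_unit]
    · rw [map_zero]
  have hdown : ∀ (p : Fin k) (i : ℤ), lev d i (modelDown K k c (Pi.single p 1)) =
      if ((p : ℕ) : ℤ) + 1 ≡ c [ZMOD 2] then vec K d (((p : ℕ) : ℤ) + 1 + 1) i else 0 := by
    intro p i
    rw [single_eq_unit, modelDown_unit p.2]
    split_ifs with h
    · rw [lev_unit]; simp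
    · rw [map_zero]
  unfold leftAction leftOf endOf
  congr 1 <;> refine opOf_congr fun a => ?_ <;>
    simp only [LinearMap.add_apply, LinearMap.sub_apply, LinearMap.smul_apply,
      LinearMap.comp_apply, hup, hdiag, hdown] <;>
    split_ifs with h
  · module
  · simp
  · rfl
  · simp
  · rfl
  · simp

theorem leftAction_congr {c' : ℤ} (h : c ≡ c' [ZMOD 2]) (d : Fin k → ℕ) :
    leftAction K d c = leftAction K d c' := by
  have : ∀ p : ℤ, p ≡ c [ZMOD 2] ↔ p ≡ c' [ZMOD 2] :=
    fun p => ⟨fun h' => h'.trans h, fun h' => h'.trans h.symm⟩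
  simp only [leftAction, this]

end Model

/-! ### Isomorphisms of bimodules -/

section Iso

variable {K L M M' M'' : Type*} [Field K] [LieRing L] [LieAlgebra K L] [AddCommGroup M]
  [Module K M] [AddCommGroup M'] [Module K M'] [AddCommGroup M''] [Module K M'']
  {l r : L →ₗ[K] Module.End K M} {l' r' : L →ₗ[K] Module.End K M'}
  {l'' r'' : L →ₗ[K] Module.End K M''}

theorem BimoduleIso.trans (h : BimoduleIso l r l' r') (h' : BimoduleIso l' r' l'' r'') :
    BimoduleIso l r l'' r'' := by
  obtain ⟨φ, hφ⟩ := h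
  obtain ⟨ψ, hψ⟩ := h'
  exact ⟨φ.trans ψ, fun x m => ⟨(congrArg ψ (hφ x m).1).trans (hψ x (φ m)).1,
    (congrArg ψ (hφ x m).2).trans (hψ x (φ m)).2⟩⟩

/-- A left action can be transported along an isomorphism of right modules. -/
theorem exists_transport (hb : IsBimodule l r) (h : RightIso r r') (hi : IsIndecomposable l r) :
    ∃ l' : L →ₗ[K] Module.End K M', IsBimodule l' r' ∧ IsIndecomposable l' r' ∧
      BimoduleIso l r l' r' := by
  obtain ⟨φ, hφ⟩ := h
  have hl : ∀ x m, φ.conj (l x) (φ m) = φ (l x m) := fun x m => by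
    rw [LinearEquiv.conj_apply_apply, LinearEquiv.symm_apply_apply]
  have hmem : ∀ (N : Submodule K M') (m : M), m ∈ N.comap φ.toLinearMap ↔ φ m ∈ N :=
    fun _ _ => Iff.rfl
  refine ⟨φ.conj.toLinearMap ∘ₗ l, ⟨fun x y m => ?_, fun x y m => ?_, fun x y m => ?_⟩,
    ⟨?_, fun N₁ N₂ h₁ h₂ hc => ?_⟩, φ, fun x m => ⟨(hl x m).symm, hφ x m⟩⟩
  · obtain ⟨m, rfl⟩ := φ.surjective m
    simp only [← hφ, hb.right_right, map_sub]
  · obtain ⟨m, rfl⟩ := φ.surjective m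
    simp only [LinearMap.comp_apply, LinearEquiv.coe_coe, hl, ← hφ, hb.left_right, map_sub]
  · obtain ⟨m, rfl⟩ := φ.surjective m
    simp only [LinearMap.comp_apply, LinearEquiv.coe_coe, hl, ← hφ, hb.left_left, map_sub]
  · have := hi.1
    exact φ.symm.toEquiv.nontrivial
  · have hsub : ∀ N : Submodule K M', IsSubbimodule (φ.conj.toLinearMap ∘ₗ l) r' N →
        IsSubbimodule l r (N.comap φ.toLinearMap) := by
      intro N hN x m hm
      have h := hN x (φ m) hm
      rw [LinearMap.comp_apply, LinearEquiv.coe_coe, hl, ← hφ] at h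
      exact h
    have hbot : ∀ N : Submodule K M', N.comap φ.toLinearMap = ⊥ → N = ⊥ := by
      intro N hN
      rw [eq_bot_iff]
      intro m hm
      obtain ⟨m, rfl⟩ := φ.surjective m
      have : m ∈ N.comap φ.toLinearMap := hm
      rw [hN, Submodule.mem_bot] at this
      rw [this, map_zero]
      exact zero_mem _
    refine (hi.2 _ _ (hsub N₁ h₁) (hsub N₂ h₂) ?_).imp (hbot N₁) (hbot N₂)
    exact (Submodule.orderIsoMapComap φ).symm.isCompl hc

end Iso

/-! ### Classification of the indecomposable bimodules -/

section Classification

variable {K : Type*} [Field K] {k n : ℕ} {d : Fin k → ℕ}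

/-- The chain of vectors in a splitting and the chain of linear forms are dual to each other. -/
theorem Splitting.form_apply_vec {a z b : Module.End K (Fin k → K)} {j : ℕ} {c : ℤ}
    {x : ℕ → Fin k → K} {y : ℕ → (Fin k → K) →ₗ[K] K} (hs : Splitting d a z b n c j x y)
    {p q : ℕ} (hp : p < j) : y p (x q) = if p = q then 1 else 0 := by
  split_ifs with h
  · subst h
    induction p with
    | zero => exact hs.form_vec
    | succ p ih =>
      rw [← ih (by omega)]
      by_cases hsrc : IsSource c p
      · have h1 := hs.form_down p hp (x p)
        rwa [hs.vec_down, if_pos hsrc, if_pos hsrc] at h1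
      · have hsrc' := (isSource_succ c p).mpr hsrc
        have h1 := hs.form_up p (x (p + 1))
        rw [hs.vec_up p hp, if_pos hsrc', if_pos hsrc'] at h1
        exact h1.symm
  · exact hs.form_of_ne p _ (by omega) _ (hs.vec_mem q)

theorem chain_antitone (n k : ℕ) : Antitone (chain n k) := by
  intro p q hpq
  have : (p : ℕ) ≤ q := hpq
  simp only [chain]
  omega

/-- A degree-preserving endomorphism for a chain of distinct degrees is diagonal. -/
theorem PreservesDegree.apply_unit {g : Module.End K (Fin k → K)} (hn : 2 * (k - 1) ≤ n)
    (hg : PreservesDegree (chain n k) (chain n k) g) (p : ℕ) :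
    g (unit K k p) = coord p (g (unit K k p)) • unit K k p := by
  refine ext_coord fun q hq => ?_
  have h := (mem_homog_chain hn).mp (hg _ _ (unit_mem_homog_chain hn p)) q hq
  rw [map_smul, coord_unit hq]
  split_ifs with hqp
  · rw [hqp, smul_eq_mul, mul_one]
  · rw [h (by omega), smul_zero]

theorem isBimodule_model (c : ℤ) (hn : 2 * (k - 1) ≤ n) :
    IsBimodule (leftAction K (chain n k) c) (chainRight K n k) := by
  rw [leftAction_eq_leftOf]
  exact isBimodule_leftOf (isGraded_model hn) isZigzag_model

variable [CharZero K]

/-- An indecomposable bimodule is isomorphic to a model: a chain starting in the highest degree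
gives homomorphisms from a model into the bimodule and back whose composition is the identity. -/
theorem exists_iso_model {l : Sl2 K →ₗ[K] Module.End K (Space K d)}
    (hl : IsBimodule l (rightAction K d)) (hi : IsIndecomposable l (rightAction K d)) :
    ∃ (n j : ℕ) (c : ℤ), 1 ≤ j ∧ 2 * (j - 1) ≤ n ∧
      BimoduleIso l (rightAction K d) (leftAction K (chain n j) c) (chainRight K n j) := by
  obtain ⟨a, z, b, hg, hz, rfl⟩ := exists_isZigzag hl
  obtain ⟨p₀, hp₀⟩ : ∃ p₀, ∀ p, d p ≤ d p₀ := by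
    rcases k.eq_zero_or_pos with rfl | hk
    · obtain ⟨s, t, hst⟩ := hi.1
      exact absurd (funext fun a => a.1.elim0) hst
    · have : Nonempty (Fin k) := ⟨⟨0, hk⟩⟩
      obtain ⟨p₀, -, h⟩ := Finset.exists_max_image Finset.univ d Finset.univ_nonempty
      exact ⟨p₀, fun p => h p (Finset.mem_univ p)⟩
  obtain ⟨c, hc⟩ : ∃ c : ℤ, part d z (d p₀) (IsSource c 0) ≠ ⊥ := by
    by_contra! hall
    have h1 := hall 1
    have h0 := hall 0
    have hu := single_mem_homog (d := d) p₀ (1 : K)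
    set u : Fin k → K := Pi.single p₀ 1 with hu_def
    have hzu : z u = 0 := by
      rw [← Submodule.mem_bot K, ← h1, mem_part_pos (by decide)]
      exact ⟨hg.diag _ u hu, hz.diag_diag u⟩
    have hu0 : u = 0 := by
      rw [← Submodule.mem_bot K, ← h0, mem_part_neg (by decide)]
      exact ⟨hu, hzu⟩
    have := congrFun hu0 p₀
    simp [hu_def] at this
  obtain ⟨j, x, y, hs, -, -⟩ := exists_splitting hg hz (d p₀) c ⊥ _ bot_le le_rfl
    (fun h => hc (le_bot_iff.mp h))
  set n := d p₀ with hn_def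
  have hj : 2 * (j - 1) ≤ n := hs.le _ (Nat.sub_lt hs.pos one_pos)
  have hgm := isGraded_model (K := K) (c := c) hj
  -- There is nothing above the top degree.
  have htop : ∀ m : ℤ, (n : ℤ) < m → ∀ u ∈ homog K d m, u = 0 := by
    intro m hm u hu
    ext p
    have := hp₀ p
    exact hu p (by omega)
  let φ : (Fin j → K) →ₗ[K] (Fin k → K) := Fintype.linearCombination K fun p : Fin j => x p
  let ψ : (Fin k → K) →ₗ[K] (Fin j → K) := LinearMap.pi fun p : Fin j => y p
  have hφ : ∀ p, φ (unit K j p) = x p := by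
    intro p
    by_cases hp : p < j
    · have h1 := single_eq_unit (K := K) (⟨p, hp⟩ : Fin j)
      simp only at h1
      rw [← h1, Fintype.linearCombination_apply_single, one_smul]
    · rw [unit_of_le (by omega), hs.vec_zero p (by omega), map_zero]
  have hψ : ∀ p, ∀ u, coord p (ψ u) = y p u := by
    intro p u
    by_cases hp : p < j
    · rw [coord_of_lt hp]; rfl
    · rw [coord_of_le (by omega), hs.form_zero p (by omega), LinearMap.zero_apply]
  have hψφ : ∀ u, ψ (φ u) = u := by
    refine LinearMap.congr_fun (f := ψ ∘ₗ φ) (g := LinearMap.id) (ext_unit fun p hp => ?_)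
    refine ext_coord fun q hq => ?_
    rw [LinearMap.comp_apply, hφ, hψ, LinearMap.id_apply, coord_unit hq, hs.form_apply_vec hq]
  have hφg : PreservesDegree (chain n j) d φ := by
    intro m u hu
    rw [mem_homog_chain hj] at hu
    rw [Fintype.linearCombination_apply]
    refine Submodule.sum_mem _ fun p _ => ?_
    by_cases hp : (n : ℤ) - 2 * (p : ℕ) = m
    · rw [← hp]
      exact Submodule.smul_mem _ _ (hs.vec_mem p)
    · have h1 := hu p p.2 hp
      rw [coord_of_lt p.2] at h1
      rw [show u p = 0 from h1, zero_smul]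
      exact zero_mem _
  have hψg : PreservesDegree d (chain n j) ψ := by
    intro m u hu
    rw [mem_homog_chain hj]
    intro p _ hne
    rw [hψ, hs.form_of_ne p m (Ne.symm hne) u hu]
  have hφl := lift_left hφg hgm hg
    (fun u => LinearMap.congr_fun (f := φ ∘ₗ modelUp K j c) (g := a ∘ₗ φ)
      (ext_unit fun p hp => by
        rw [LinearMap.comp_apply, LinearMap.comp_apply, hφ]
        cases p with
        | zero =>
          rw [modelUp_unit_zero, map_zero,
            htop _ (by push_cast; omega) _ (hg.up _ _ (hs.vec_mem 0))]
        | succ p =>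
          rw [modelUp_unit_succ hp, hs.vec_up p hp]
          split_ifs
          · exact hφ p
          · exact map_zero φ) u)
    (fun u => LinearMap.congr_fun (f := φ ∘ₗ modelDiag K j c) (g := z ∘ₗ φ)
      (ext_unit fun p hp => by
        rw [LinearMap.comp_apply, LinearMap.comp_apply, hφ, modelDiag_unit, hs.vec_diag]
        split_ifs
        · exact hφ p
        · exact map_zero φ) u)
    (fun u => LinearMap.congr_fun (f := φ ∘ₗ modelDown K j c) (g := b ∘ₗ φ)
      (ext_unit fun p hp => by
        rw [LinearMap.comp_apply, LinearMap.comp_apply, hφ, modelDown_unit hp, hs.vec_down]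
        split_ifs
        · exact hφ (p + 1)
        · exact map_zero φ) u)
  have hψl := lift_left hψg hg hgm
    (fun u => ext_coord fun p hp => by rw [hψ, hs.form_up, coord_modelUp hp, hψ])
    (fun u => ext_coord fun p hp => by rw [hψ, hs.form_diag, coord_modelDiag, hψ])
    (fun u => LinearMap.congr_fun (f := ψ ∘ₗ b) (g := modelDown K j c ∘ₗ ψ)
      (linearMap_ext_homog (d := d) fun m _ u hu => ext_coord fun p hp => by
        rw [LinearMap.comp_apply, LinearMap.comp_apply, hψ]
        cases p with
        | zero =>
          rw [coord_zero_modelDown]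
          by_cases hm : m - 2 = n
          · rw [htop m (by omega) u hu, map_zero, map_zero]
          · exact hs.form_of_ne 0 (m - 2) (by simpa using hm) _ (hg.down m u hu)
        | succ p => rw [hs.form_down p hp, coord_succ_modelDown hp, hψ]) u)
  have hφr := lift_right hφg
  have hψr := lift_right hψg
  rw [← leftAction_eq_leftOf] at hφl hψl
  set Φ := lift (chain n j) d φ
  set Ψ := lift d (chain n j) ψ
  have hΨΦ : ∀ v, Ψ (Φ v) = v := by
    refine LinearMap.congr_fun (f := Ψ ∘ₗ Φ) (g := LinearMap.id)
      (space_ext fun m i _ _ u hu => ?_)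
    rw [LinearMap.comp_apply, lift_lev hφg hu, lift_lev hψg (hφg m u hu), hψφ]
    rfl
  have hcompl : IsCompl (LinearMap.range Φ) (LinearMap.ker Ψ) := by
    refine ⟨Submodule.disjoint_def.mpr ?_, codisjoint_iff.mpr (eq_top_iff.mpr fun v _ => ?_)⟩
    · rintro _ ⟨v, rfl⟩ hv
      rw [LinearMap.mem_ker, hΨΦ] at hv
      rw [hv, map_zero]
    · refine Submodule.mem_sup.mpr ⟨Φ (Ψ v), ⟨_, rfl⟩, v - Φ (Ψ v), ?_, by abel⟩
      rw [LinearMap.mem_ker, map_sub, hΨΦ, sub_self]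
  have hker : LinearMap.ker Ψ = ⊥ := by
    refine (hi.2 _ _ ?_ ?_ hcompl).resolve_left fun h0 => ?_
    · rintro x _ ⟨v, rfl⟩
      exact ⟨⟨_, hφl x v⟩, ⟨_, hφr x v⟩⟩
    · intro x v hv
      rw [LinearMap.mem_ker] at hv
      rw [LinearMap.mem_ker, LinearMap.mem_ker, hψl, hψr, hv, map_zero, map_zero]
      exact ⟨rfl, rfl⟩
    · have h1 := hΨΦ (lev (chain n j) 0 (unit K j 0))
      rw [LinearMap.range_eq_bot.mp h0, LinearMap.zero_apply, map_zero] at h1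
      have h2 := congrArg (fun v => coord 0 (top (chain n j) v)) h1
      simp only [map_zero, top_lev_zero, coord_unit hs.pos, if_true] at h2
      exact zero_ne_one h2
  have hbij : Function.Bijective Ψ :=
    ⟨LinearMap.ker_eq_bot.mp hker, fun v => ⟨Φ v, hΨΦ v⟩⟩
  exact ⟨n, j, c, hs.pos, hj, LinearEquiv.ofBijective Ψ hbij, fun x v => ⟨hψl x v, hψr x v⟩⟩

theorem isIndecomposable_model (c : ℤ) (hk : 1 ≤ k) (hn : 2 * (k - 1) ≤ n) :
    IsIndecomposable (leftAction K (chain n k) c) (chainRight K n k) := by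
  refine ⟨⟨lev _ 0 (unit K k 0), 0, fun h => ?_⟩, fun N₁ N₂ h₁ h₂ hc => ?_⟩
  · have h2 := congrArg (fun v => coord 0 (top (chain n k) v)) h
    simp only [map_zero, top_lev_zero, coord_unit (show 0 < k by omega), if_true] at h2
    exact one_ne_zero h2
  set π : Space K (chain n k) →ₗ[K] Space K (chain n k) := N₁.subtype ∘ₗ N₁.projectionOnto N₂ hc
  have hπ₁ : ∀ v ∈ N₁, π v = v := fun v hv => by
    simp only [π, LinearMap.comp_apply]
    exact congrArg Subtype.val (Submodule.projectionOnto_apply_left hc ⟨v, hv⟩)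
  have hπ₂ : ∀ v ∈ N₂, π v = 0 := fun v hv => by
    simp only [π, LinearMap.comp_apply]
    rw [(Submodule.projectionOnto_apply_eq_zero_iff hc).mpr hv, map_zero]
  have hcomm : ∀ f : Module.End K (Space K (chain n k)), (∀ v ∈ N₁, f v ∈ N₁) →
      (∀ v ∈ N₂, f v ∈ N₂) → ∀ v, π (f v) = f (π v) := by
    intro f hf₁ hf₂ v
    obtain ⟨v₁, hv₁, v₂, hv₂, rfl⟩ := Submodule.mem_sup.mp
      ((codisjoint_iff.mp hc.codisjoint).symm ▸ Submodule.mem_top : v ∈ N₁ ⊔ N₂)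
    rw [map_add, map_add, map_add, hπ₁ _ (hf₁ v₁ hv₁), hπ₂ _ (hf₂ v₂ hv₂), hπ₁ _ hv₁, hπ₂ _ hv₂,
      add_zero, add_zero]
  obtain ⟨g, hg, hπg⟩ := exists_eq_lift (φ := π) fun x v =>
    hcomm (chainRight K n k x) (fun v hv => (h₁ x v hv).2) (fun v hv => (h₂ x v hv).2) v
  have hgm := isGraded_model (K := K) (c := c) hn
  have hint := fun (m : ℤ) (hm : 0 ≤ m) u (hu : u ∈ homog K (chain n k) m) =>
    intertwines_of_lift hg hgm hgm (fun x v => by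
      rw [← hπg, ← leftAction_eq_leftOf]
      exact hcomm (leftAction K (chain n k) c x) (fun v hv => (h₁ x v hv).1)
        (fun v hv => (h₂ x v hv).1) v) hm hu
  -- Adjacent coordinates are linked by the up or down map, hence have the same eigenvalue.
  have hγ : ∀ p < k, g (unit K k p) = coord 0 (g (unit K k 0)) • unit K k p := by
    intro p
    induction p with
    | zero => exact fun _ => hg.apply_unit hn 0
    | succ p ih =>
      intro hp
      have ih' := ih (by omega)
      by_cases hs : IsSource c p
      · have h := (hint _ (by omega) _ (unit_mem_homog_chain hn p)).2.2
        rwa [modelDown_unit (by omega), if_pos hs, ih', map_smul, modelDown_unit (by omega),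
          if_pos hs] at h
      · have hs' := (isSource_succ c p).mpr hs
        have h := (hint _ (by push_cast; omega) _ (unit_mem_homog_chain hn (p + 1))).1
        rw [modelUp_unit_succ hp, if_pos hs', hg.apply_unit hn (p + 1), map_smul,
          modelUp_unit_succ hp, if_pos hs', ih'] at h
        have h' := congrArg (coord p) h
        rw [map_smul, map_smul, coord_unit (by omega), if_pos rfl, smul_eq_mul, smul_eq_mul,
          mul_one, mul_one] at h'
        rw [hg.apply_unit hn (p + 1), ← h']
  have hπ : ∀ v, π v = coord 0 (g (unit K k 0)) • v := by
    have hg' : g = coord 0 (g (unit K k 0)) • LinearMap.id := ext_unit fun p hp => hγ p hp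
    refine LinearMap.congr_fun (f := π) (g := coord 0 (g (unit K k 0)) • LinearMap.id)
      (space_ext fun m i _ _ u hu => ?_)
    rw [hπg, lift_lev hg hu, LinearMap.congr_fun hg' u]
    simp
  by_contra! hne
  obtain ⟨v, hv, hv0⟩ := Submodule.exists_mem_ne_zero_of_ne_bot hne.1
  obtain ⟨w, hw, hw0⟩ := Submodule.exists_mem_ne_zero_of_ne_bot hne.2
  have hγ1 : coord 0 (g (unit K k 0)) ≠ 0 := by
    intro h0
    have := hπ₁ v hv
    rw [hπ, h0, zero_smul] at this
    exact hv0 this.symm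
  have := hπ₂ w hw
  rw [hπ, smul_eq_zero] at this
  exact this.elim hγ1 hw0

/-- The kinds differ by whether the top component is a source, which the diagonal part of the left
action detects unless its degree is zero. -/
theorem leftFirst_iso_leftSecond_iff (hk : 1 ≤ k) (hn : 2 * (k - 1) ≤ n) :
    BimoduleIso (leftFirst K n k) (chainRight K n k) (leftSecond K n k) (chainRight K n k) ↔
      n = 0 := by
  have hg0 := isGraded_model (K := K) (c := 0) hn
  have hg1 := isGraded_model (K := K) (c := 1) hn
  constructor
  · rintro ⟨φ, hφ⟩
    obtain ⟨g, hg, hφg⟩ := exists_eq_lift (φ := φ.toLinearMap) fun x v => (hφ x v).2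
    have h := (intertwines_of_lift hg hg0 hg1 (fun x v => by
      rw [← hφg, ← leftAction_eq_leftOf, ← leftAction_eq_leftOf]
      exact (hφ x v).1) (by simp) (unit_mem_homog_chain hn 0)).2.1
    rw [modelDiag_unit, if_neg (by decide), map_zero, smul_zero, hg.apply_unit hn 0,
      map_smul, modelDiag_unit, if_pos (by decide), ← hg.apply_unit hn 0, eq_comm,
      smul_eq_zero] at h
    refine h.elim (fun h => by simpa using h) fun h => ?_
    have h1 : φ.toLinearMap (lev (chain n k) 0 (unit K k 0)) = 0 := by
      rw [hφg, lift_lev hg (unit_mem_homog_chain hn 0), h, map_zero]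
    have h2 : lev (chain n k) 0 (unit K k 0) = 0 := φ.map_eq_zero_iff.mp h1
    have h3 := congrArg (fun v => coord 0 (top (chain n k) v)) h2
    simp only [map_zero, top_lev_zero, coord_unit (show 0 < k by omega), if_true] at h3
    exact absurd h3 one_ne_zero
  · rintro rfl
    obtain rfl : k = 1 := by omega
    have hup : modelUp K 1 0 = modelUp K 1 1 := LinearMap.ext fun u => ext_coord fun p hp => by
      rw [coord_modelUp hp, coord_modelUp hp, coord_of_le (by omega), ite_self, ite_self]
    have hdown : modelDown K 1 0 = modelDown K 1 1 :=
      LinearMap.ext fun u => ext_coord fun p hp => by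
        obtain rfl : p = 0 := by omega
        rw [coord_zero_modelDown, coord_zero_modelDown]
    have : leftFirst K 0 1 = leftSecond K 0 1 := by
      rw [leftFirst, leftSecond, leftAction_eq_leftOf, leftAction_eq_leftOf]
      rw [hup, hdown] at hg0 ⊢
      refine leftOf_congr_diag hg0 hg1 fun m hm u hu => ?_
      have hu0 : u = 0 := by
        ext p
        exact hu p (by simpa [chain] using hm.symm)
      rw [hu0, map_zero, map_zero]
    rw [this]
    exact ⟨LinearEquiv.refl K _, fun x m => ⟨rfl, rfl⟩⟩

/-- An indecomposable bimodule has the right weights of a model, and is isomorphic to it. -/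
theorem exists_iso_model_of_rightIso {M : Type*} [AddCommGroup M] [Module K M]
    {l r : Sl2 K →ₗ[K] Module.End K M} (hd : Antitone d) (hb : IsBimodule l r)
    (hr : RightIso r (rightAction K d)) (hi : IsIndecomposable l r) :
    ∃ (n : ℕ) (c : ℤ), 2 * (k - 1) ≤ n ∧ d = chain n k ∧
      BimoduleIso l r (leftAction K (chain n k) c) (chainRight K n k) := by
  obtain ⟨l', hb', hi', hiso⟩ := exists_transport hb hr hi
  obtain ⟨n, j, c, -, hj, hiso'⟩ := exists_iso_model hb' hi'
  obtain ⟨rfl, h⟩ := eq_of_rightIso (chain_antitone n j) hd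
    (hiso'.imp fun φ hφ x m => (hφ x m).2)
  exact ⟨n, c, hj, funext h, hiso.trans hiso'⟩

end Classification

end LeibnizSl2

theorem theorem3p6 {K : Type*} [Field K] [CharZero K] :
    -- an indecomposable bimodule has right highest weights decreasing by exactly two
    (∀ (k : ℕ) (d : Fin k → ℕ), Antitone d →
      ∀ (M : Type*) [AddCommGroup M] [Module K M] (l r : Sl2 K →ₗ[K] Module.End K M),
        IsBimodule l r → RightIso r (rightAction K d) → IsIndecomposable l r →
        ∀ (i : ℕ) (hi : i + 1 < k), d ⟨i, Nat.lt_of_succ_lt hi⟩ = d ⟨i + 1, hi⟩ + 2) ∧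
    -- for each such sequence the two explicit bimodules are all the indecomposable ones
    (∀ n k : ℕ, 1 ≤ k → 2 * (k - 1) ≤ n →
      (IsBimodule (leftFirst K n k) (chainRight K n k) ∧
        IsIndecomposable (leftFirst K n k) (chainRight K n k)) ∧
      (IsBimodule (leftSecond K n k) (chainRight K n k) ∧
        IsIndecomposable (leftSecond K n k) (chainRight K n k)) ∧
      (BimoduleIso (leftFirst K n k) (chainRight K n k) (leftSecond K n k) (chainRight K n k) ↔
        n = 0) ∧
      ∀ (M : Type*) [AddCommGroup M] [Module K M] (l r : Sl2 K →ₗ[K] Module.End K M),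
        IsBimodule l r → RightIso r (chainRight K n k) → IsIndecomposable l r →
        BimoduleIso l r (leftFirst K n k) (chainRight K n k) ∨
        BimoduleIso l r (leftSecond K n k) (chainRight K n k)) := by
  refine ⟨fun k d hd M _ _ l r hb hr hi i h => ?_, fun n k hk hn => ⟨⟨isBimodule_model 0 hn,
    isIndecomposable_model 0 hk hn⟩, ⟨isBimodule_model 1 hn, isIndecomposable_model 1 hk hn⟩,
    leftFirst_iso_leftSecond_iff hk hn, fun M _ _ l r hb hr hi => ?_⟩⟩
  · obtain ⟨n, -, hn, rfl, -⟩ := exists_iso_model_of_rightIso hd hb hr hi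
    simp only [chain]
    omega
  · obtain ⟨n', c, hn', hnn', hiso⟩ := exists_iso_model_of_rightIso (chain_antitone n k) hb hr hi
    obtain rfl : n = n' := by simpa [chain] using congrFun hnn' ⟨0, hk⟩
    rcases Int.emod_two_eq_zero_or_one c with hc | hc
    · left
      rwa [leftAction_congr (c := c) (c' := 0) hc] at hiso
    · right
      rwa [leftAction_congr (c := c) (c' := 1) hc] at hiso
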